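/- Let $V$ be a real vector space of dimension $n$ and let $0\le k\le n$. Write $\mathbb P_+(V^*)$ for the oriented projectivization of $V^*$ (the manifold of rays), $\mathrm{Dens}(V)$ for the complex line of densities and $\mathrm{or}(V)$ for the line of orientation functions on $V$. For finite-dimensional $F$, the space $\Omega^{p}_{-\infty}(V^*,F)$ of generalized $p$-forms with values in $F$ is the dual of the space of compactly supported smooth $(n-p)$-forms on $V^*$ with values in $F^*\otimes\mathrm{or}(V^*)$; similarly on $\mathbb P_+(V^*)$. For $k>0$ let $\mathrm{Val}^\infty_{n-k}(V)$ be the space of valuations $K\mapsto\int_{\mathrm{nc}(K)}\alpha$ on convex bodies, where $\mathrm{nc}(K)\subset V\times\mathbb P_+(V^*)$ is the normal cycle of $K$ and $\alpha\in\Omega^{k-1}(\mathbb P_+(V^*),\wedge^{n-k}V^*\otimes\mathrm{or}(V))$ is a smooth form, regarded as a translation-invariant form on $V\times\mathbb P_+(V^*)$; it carries the quotient of the $C^\infty$ topology on these forms. Let $\mathrm{Val}^\infty_n(V)=\mathrm{Dens}(V)$. A generalized valuation $\phi\in\mathrm{Val}^{-\infty}_k(V)$ is a continuous linear functional on $\mathrm{Val}^\infty_{n-k}(V)\otimes\mathrm{Dens}(V)^*$.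 The $0$-homogeneous current $\tau=\tau(\phi)\in\Omega^{n-k}_{-\infty}(V^*,\wedge^kV^*\otimes\mathrm{or}(V))$ of $\phi$ is defined as follows. * If $k>0$, then $\alpha\mapsto\phi\big(\int_{\mathrm{nc}(\cdot)}\alpha\big)$ is a generalized form $S\in\Omega^{n-k}_{-\infty}(\mathbb P_+(V^*),\wedge^{n-k}V\otimes\mathrm{Dens}(V))$. Put $T=(-1)^{k(n-k)}\,{*_{V^*}}\circ S\in\Omega^{n-k}_{-\infty}(\mathbb P_+(V^*),\wedge^{k}V^*\otimes\mathrm{or}(V))$, where $*_{V^*}$ is the Hodge star $\wedge^{n-k}V\simeq\wedge^kV^*\otimes\wedge^nV$. Then $\tau$ is the $0$-homogeneous extension of $T$: $\langle\tau,\eta\rangle=\langle T,\pi_*\eta\rangle$, where $\pi_*$ is integration along the fibres of $\pi\colon V^*\setminus\{0\}\to\mathbb P_+(V^*)$. * If $k=0$, then $\phi=c\,\chi$ with $\chi$ the Euler characteristic, and $\tau=c\,\delta_0$. Let $\overline\tau\in\Omega^{n-k}_{-\infty}(V^*,\wedge^{n-k}V\otimes\mathrm{Dens}(V))$ be the generalized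 form corresponding to $\tau$ under the Hodge star isomorphism $\wedge^kV^*\simeq\wedge^{n-k}V\otimes\wedge^nV^*$. Since $(n-k)$-covectors of the manifold $V^*$ are elements of $\wedge^{n-k}V$, it may be considered as a generalized function $\overline\tau\in C^{-\infty}(V^*,\wedge^{n-k}V\otimes\wedge^{n-k}V\otimes\mathrm{Dens}(V))$. **Proposition.** For every $\phi\in\mathrm{Val}_k^{-\infty}(V)$, the generalized function $\overline\tau$ belongs to the subspace $C^{-\infty}(V^*,\mathrm{Sym}^2(\wedge^{n-k}V)\otimes\mathrm{Dens}(V))$. -/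

import Mathlib

open scoped ContDiff TensorProduct
open MeasureTheory Module

universe u

section
variable {W : Type u} [NormedAddCommGroup W] [NormedSpace ℝ W]

/-- The space `Ω_c^p(W, F)` of compactly supported smooth `p`-forms on `W` with values in the
complex vector space `F`.  A generalized `q`-form on the `n`-dimensional space `W`, with values in a
space with dual `F`, is a linear functional on `Ω_c^{n-q}(W, F)` (orientations being trivialized by
a basis). -/
def testForms (W : Type*) [NormedAddCommGroup W] [NormedSpace ℝ W] (p : ℕ) (F : Type*)
    [NormedAddCommGroup F] [NormedSpace ℝ F] [NormedSpace ℂ F] [SMulCommClass ℝ ℂ F] :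
    Submodule ℂ (W → W [⋀^Fin p]→L[ℝ] F) where
  carrier := {η | ContDiff ℝ ∞ η ∧ HasCompactSupport η}
  zero_mem' := ⟨contDiff_const, HasCompactSupport.zero⟩
  add_mem' hf hg := ⟨hf.1.add hg.1, hf.2.add hg.2⟩
  smul_mem' c _ hf := ⟨hf.1.const_smul c, hf.2.smul_left (f := fun _ => c)⟩

/-- Complex-valued compactly supported smooth functions on `W`. -/
def testFunctions (W : Type*) [NormedAddCommGroup W] [NormedSpace ℝ W] : Submodule ℂ (W → ℂ) where
  carrier := {g | ContDiff ℝ ∞ g ∧ HasCompactSupport g}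
  zero_mem' := ⟨contDiff_const, HasCompactSupport.zero⟩
  add_mem' hf hg := ⟨hf.1.add hg.1, hf.2.add hg.2⟩
  smul_mem' c _ hf := ⟨hf.1.const_smul c, hf.2.smul_left (f := fun _ => c)⟩

theorem contDiff_intervalIntegral_param [FiniteDimensional ℝ W] (n : ℕ) :
    ∀ {G : Type u} [NormedAddCommGroup G] [NormedSpace ℝ G] (f : W × ℝ → G) (_ : ContDiff ℝ ∞ f) (a b : ℝ),
    ContDiff ℝ n (fun x => ∫ t in a..b, f (x, t)) := by
  induction n with
  | zero =>
    intro G _ _ f hf a b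
    simp only [Nat.cast_zero, contDiff_zero]
    exact intervalIntegral.continuous_parametric_intervalIntegral_of_continuous' (f := fun x t => f (x, t)) hf.continuous a b
  | succ n ih =>
    intro G _ _ f hf a b
    have hf' : ContDiff ℝ ∞ (fun p : W × ℝ => (fderiv ℝ f p).comp (ContinuousLinearMap.inl ℝ W ℝ)) :=
      (hf.fderiv_right (m := ∞) (by simp)).clm_comp contDiff_const
    have key : ∀ x, HasFDerivAt (fun x => ∫ t in a..b, f (x, t))
        (∫ t in a..b, (fderiv ℝ f (x, t)).comp (ContinuousLinearMap.inl ℝ W ℝ)) x := by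
      intro x
      obtain ⟨C, hC⟩ := ((isCompact_closedBall x 1).prod (isCompact_uIcc (a := a) (b := b))).exists_bound_of_continuousOn
        hf'.continuous.continuousOn
      refine (intervalIntegral.hasFDerivAt_integral_of_dominated_of_fderiv_le (μ := volume)
        (F := fun x t => f (x, t))
        (F' := fun x t => (fderiv ℝ f (x, t)).comp (ContinuousLinearMap.inl ℝ W ℝ))
        (bound := fun _ => C) (s := Metric.closedBall x 1) (Metric.closedBall_mem_nhds x one_pos) ?_ ?_ ?_ ?_ ?_ ?_)
      · exact Filter.Eventually.of_forall fun y => by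
          have : Continuous (fun t => f (y, t)) := hf.continuous.comp (by fun_prop)
          exact this.aestronglyMeasurable
      · have : Continuous (fun t => f (x, t)) := hf.continuous.comp (by fun_prop)
        exact this.intervalIntegrable _ _
      · have : Continuous (fun t : ℝ => (fderiv ℝ f (x, t)).comp (ContinuousLinearMap.inl ℝ W ℝ)) :=
          hf'.continuous.comp (by fun_prop : Continuous fun t : ℝ => (x, t))
        exact this.aestronglyMeasurable
      · refine Filter.Eventually.of_forall fun t ht y hy => hC (y, t) ⟨hy, Set.uIoc_subset_uIcc ht⟩
      · exact intervalIntegrable_const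
      · refine Filter.Eventually.of_forall fun t ht y hy => ?_
        have h1 : HasFDerivAt f (fderiv ℝ f (y, t)) (y, t) :=
          (hf.differentiable (by simp) _).hasFDerivAt
        exact h1.comp y (hasFDerivAt_prodMk_left y t)
    have : fderiv ℝ (fun x => ∫ t in a..b, f (x, t)) = fun x => ∫ t in a..b, (fderiv ℝ f (x, t)).comp (ContinuousLinearMap.inl ℝ W ℝ) :=
      funext fun x => (key x).fderiv
    rw [show ((n + 1 : ℕ) : WithTop ℕ∞) = (n : WithTop ℕ∞) + 1 by simp, contDiff_succ_iff_fderiv]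
    refine ⟨fun x => (key x).differentiableAt, by simp, ?_⟩
    rw [this]
    exact ih _ hf' a b
end

/-- Smooth `j`-forms with values in `F` on the oriented projectivization `ℙ₊(W)`, the manifold of
rays of `W`.  Pulling back along `W ∖ {0} → ℙ₊(W)` identifies them with the smooth forms on
`W ∖ {0}` which are invariant under positive dilations and are annihilated by contraction with
the Euler field.  The value at `0` carries no information and is normalized to be `0`. -/
def projForms (W : Type*) [NormedAddCommGroup W] [NormedSpace ℝ W] (j : ℕ) (F : Type*)
    [NormedAddCommGroup F] [NormedSpace ℝ F] [NormedSpace ℂ F] [SMulCommClass ℝ ℂ F] :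
    Submodule ℂ (W → W [⋀^Fin j]→L[ℝ] F) where
  carrier := {α | ContDiffOn ℝ ∞ α {0}ᶜ ∧ α 0 = 0 ∧
    (∀ (t : ℝ) (ξ : W), 0 < t → t ^ j • α (t • ξ) = α ξ) ∧
    ∀ (ξ : W) (v : Fin j → W), (∃ i, v i = ξ) → α ξ v = 0}
  zero_mem' := ⟨contDiffOn_const, rfl, by simp, by simp⟩
  add_mem' := by
    rintro f g ⟨h1, h2, h3, h4⟩ ⟨k1, k2, k3, k4⟩
    refine ⟨h1.add k1, by simp [h2, k2], fun t ξ ht => ?_, fun ξ v hv => ?_⟩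
    · simp [smul_add, h3 t ξ ht, k3 t ξ ht]
    · simp [h4 ξ v hv, k4 ξ v hv]
  smul_mem' := by
    rintro c f ⟨h1, h2, h3, h4⟩
    refine ⟨h1.const_smul c, by simp [h2], fun t ξ ht => ?_, fun ξ v hv => ?_⟩
    · rw [Pi.smul_apply, Pi.smul_apply, smul_comm, h3 t ξ ht]
    · simp [h4 ξ v hv]

section
variable {W : Type u} [NormedAddCommGroup W] [NormedSpace ℝ W]
  {F : Type u} [NormedAddCommGroup F] [NormedSpace ℝ F] [NormedSpace ℂ F] [IsScalarTower ℝ ℂ F]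
  {G : Type u} [NormedAddCommGroup G] [NormedSpace ℝ G] [NormedSpace ℂ G] [IsScalarTower ℝ ℂ G]

/-- Apply a linear map `L` to the values of a `p`-form on `W`. -/
noncomputable def postcompAlt (W : Type u) [NormedAddCommGroup W] [NormedSpace ℝ W] (p : ℕ) (L : F →L[ℂ] G) :
    (W [⋀^Fin p]→L[ℝ] F) →ₗ[ℂ] (W [⋀^Fin p]→L[ℝ] G) where
  toFun f := (L.restrictScalars ℝ).compContinuousAlternatingMap f
  map_add' f g := by ext v; simp
  map_smul' c f := by ext v; simp

theorem contDiff_postcompAlt (p : ℕ) (L : F →L[ℂ] G) : ContDiff ℝ ∞ (postcompAlt W p L) :=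
  (ContinuousLinearMap.compContinuousAlternatingMapCLM ℝ W F G (ι := Fin p) (L.restrictScalars ℝ)).contDiff

/-- Apply a linear map `L` to the values of a test form. -/
noncomputable def testForms.postcomp {p : ℕ} (L : F →L[ℂ] G) :
    testForms W p F →ₗ[ℂ] testForms W p G where
  toFun η := ⟨fun ξ => postcompAlt W p L (η.1 ξ),
    (contDiff_postcompAlt p L).comp η.2.1, η.2.2.comp_left (map_zero _)⟩
  map_add' η η' := by ext1; funext ξ; simp
  map_smul' c η := by ext1; funext ξ; simp

/-- Apply a linear map `L` to the values of a form on `ℙ₊(W)`. -/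
noncomputable def projForms.postcomp {j : ℕ} (L : F →L[ℂ] G) :
    projForms W j F →ₗ[ℂ] projForms W j G where
  toFun α := ⟨fun ξ => postcompAlt W j L (α.1 ξ),
    (contDiff_postcompAlt j L).comp_contDiffOn α.2.1, by simp [α.2.2.1],
    fun t ξ ht => by
      show _ = postcompAlt W j L (α.1 ξ)
      rw [← α.2.2.2.1 t ξ ht]
      ext v
      exact ((L.restrictScalars ℝ).map_smul _ _).symm,
    fun ξ v hv => by
      have := α.2.2.2.2 ξ v hv
      simp [postcompAlt, this]⟩
  map_add' η η' := by ext1; funext ξ; simp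
  map_smul' c η := by ext1; funext ξ; simp

theorem integrable_ray {j : ℕ} (η : testForms W (j + 1) F) (ξ : W) :
    IntegrableOn (fun t : ℝ => t ^ j • (η.1 (t • ξ)).curryLeft ξ) (Set.Ioi 0) := by
  rcases eq_or_ne ξ 0 with rfl | hξ
  · simp only [map_zero, smul_zero]
    exact integrable_zero ℝ (W [⋀^Fin j]→L[ℝ] F) _
  obtain ⟨R, hR⟩ := η.2.2.isCompact.isBounded.exists_norm_le
  have hc : Continuous (fun t : ℝ => t ^ j • (η.1 (t • ξ)).curryLeft ξ) := by
    have h1 : Continuous fun t : ℝ => η.1 (t • ξ) := η.2.1.continuous.comp (by fun_prop)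
    have h2 : Continuous fun t : ℝ => (η.1 (t • ξ)).curryLeft :=
      (ContinuousAlternatingMap.curryLeftLI (𝕜 := ℝ) (E := W) (F := F) (n := j)).continuous.comp h1
    exact (continuous_pow j).smul (h2.clm_apply continuous_const)
  refine (hc.integrable_of_hasCompactSupport ?_).integrableOn
  refine HasCompactSupport.intro (isCompact_closedBall (0 : ℝ) (R / ‖ξ‖)) fun t ht => ?_
  have : η.1 (t • ξ) = 0 := by
    by_contra h
    apply ht
    have := hR _ (subset_tsupport _ h)
    rw [norm_smul] at this
    rw [mem_closedBall_zero_iff, le_div_iff₀ (norm_pos_iff.2 hξ)]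
    exact this
  simp [this]

/-- Fiber integration `π_* : Ω_c^{j+1}(W, F) → Ω^j(ℙ₊(W), F)` along `π : W ∖ {0} → ℙ₊(W)`, where
`dim W = m + j + 1`.  For `η = f dr ∧ π^*ξ` it gives `(-1)^m (∫₀^∞ f dr) ξ`; in the present model
`(π_* η)_ξ = (-1)^m ∫₀^∞ (δ_t^* (i_E η))_ξ dt/t` with `δ_t` the dilation by `t` and `E` the Euler
field. -/
noncomputable def fiberIntegral [FiniteDimensional ℝ W] [CompleteSpace F] (m j : ℕ) :
    testForms W (j + 1) F →ₗ[ℂ] projForms W j F where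
  toFun η := ⟨fun ξ => (-1 : ℝ) ^ m • ∫ t in Set.Ioi (0 : ℝ), t ^ j • (η.1 (t • ξ)).curryLeft ξ, by
    refine ⟨?_, by simp, fun t ξ ht => ?_, fun ξ v hv => ?_⟩
    · intro ξ₀ hξ₀
      obtain ⟨R, hR⟩ := η.2.2.isCompact.isBounded.exists_norm_le
      have hξ₀' : 0 < ‖ξ₀‖ := norm_pos_iff.2 hξ₀
      set b : ℝ := 2 * |R| / ‖ξ₀‖ with hb
      have hb0 : 0 ≤ b := by positivity
      have hs : ContDiff ℝ ∞ (fun p : W × ℝ => p.2 ^ j • (η.1 (p.2 • p.1)).curryLeft p.1) := by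
        have hcl : ContDiff ℝ ∞ (fun f : W [⋀^Fin (j + 1)]→L[ℝ] F => f.curryLeft) :=
          IsBoundedLinearMap.contDiff
            { map_add := ContinuousAlternatingMap.curryLeft_add
              map_smul := ContinuousAlternatingMap.curryLeft_smul
              bound := ⟨1, one_pos, fun f => by
                rw [ContinuousAlternatingMap.norm_curryLeft, one_mul]⟩ }
        have h1 : ContDiff ℝ ∞ fun p : W × ℝ => η.1 (p.2 • p.1) :=
          η.2.1.comp (contDiff_snd.smul contDiff_fst)
        have h2 : ContDiff ℝ ∞ fun p : W × ℝ => (η.1 (p.2 • p.1)).curryLeft :=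
          hcl.comp h1
        exact (contDiff_snd.pow j).smul (h2.clm_apply contDiff_fst)
      have hI : ContDiff ℝ ∞ (fun ξ : W => ∫ t in (0 : ℝ)..b, t ^ j • (η.1 (t • ξ)).curryLeft ξ) :=
        contDiff_infty.2 fun n => contDiff_intervalIntegral_param n _ hs 0 b
      refine (((hI.const_smul ((-1 : ℝ) ^ m)).contDiffAt (x := ξ₀)).congr_of_eventuallyEq
        ?_).contDiffWithinAt
      have hev : ∀ᶠ ξ in nhds ξ₀, ‖ξ₀‖ / 2 < ‖ξ‖ :=
        continuous_norm.continuousAt.eventually (lt_mem_nhds (by linarith))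
      filter_upwards [hev] with ξ hξ
      show _ = (-1 : ℝ) ^ m • (∫ t in (0 : ℝ)..b, t ^ j • (η.1 (t • ξ)).curryLeft ξ)
      congr 1
      rw [intervalIntegral.integral_of_le hb0]
      refine setIntegral_eq_of_subset_of_forall_sdiff_eq_zero measurableSet_Ioi
        Set.Ioc_subset_Ioi_self fun t ht => ?_
      have ht0 : 0 < t := ht.1
      have htb : b < t := by
        by_contra h
        exact ht.2 ⟨ht0, not_lt.1 h⟩
      have : η.1 (t • ξ) = 0 := by
        by_contra h
        have h1 := hR _ (subset_tsupport _ h)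
        rw [norm_smul, Real.norm_of_nonneg ht0.le] at h1
        rw [hb, div_lt_iff₀ hξ₀'] at htb
        nlinarith [le_abs_self R]
      simp [this]
    · rw [smul_comm]
      congr 1
      have h := integral_comp_mul_left_Ioi
        (fun s : ℝ => s ^ j • (η.1 (s • ξ)).curryLeft ξ) 0 ht
      rw [mul_zero] at h
      have h2 : ∀ s : ℝ, s ^ j • (η.1 (s • t • ξ)).curryLeft (t • ξ)
          = (t * (t ^ j)⁻¹) • ((t * s) ^ j • (η.1 ((t * s) • ξ)).curryLeft ξ) := by
        intro s
        rw [map_smul, smul_smul, smul_smul, smul_smul, mul_comm t s]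
        congr 1
        rw [mul_pow]
        field_simp
      simp_rw [h2]
      rw [integral_smul, h, smul_smul, smul_smul]
      rw [show t ^ j * (t * (t ^ j)⁻¹) * t⁻¹ = 1 by field_simp, one_smul]
    · rw [ContinuousAlternatingMap.smul_apply]
      have h := (ContinuousAlternatingMap.apply ℝ W F v).integral_comp_comm (integrable_ray η ξ)
      simp only [ContinuousAlternatingMap.apply_apply] at h
      rw [← h]
      obtain ⟨i, hi⟩ := hv
      have h0 : ∀ t : ℝ, (t ^ j • (η.1 (t • ξ)).curryLeft ξ) v = 0 := by
        intro t
        rw [ContinuousAlternatingMap.smul_apply, ContinuousAlternatingMap.curryLeft_apply_apply,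
          (η.1 (t • ξ)).map_eq_zero_of_eq (i := 0) (j := i.succ) _ (by simp [hi])
            (Fin.succ_ne_zero i).symm, smul_zero]
      simp [h0]⟩
  map_add' η η' := by
    ext1; funext ξ
    have := integral_add (integrable_ray η ξ) (integrable_ray η' ξ)
    simp only [Submodule.coe_add, Pi.add_apply, ContinuousAlternatingMap.curryLeft_add,
      add_apply, smul_add] at this ⊢
    rw [this, smul_add]
  map_smul' c η := by
    ext1; funext ξ
    have h : ∀ t : ℝ, t ^ j • ((c • η.1 (t • ξ)).curryLeft ξ)
        = c • (t ^ j • (η.1 (t • ξ)).curryLeft ξ) := by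
      intro t
      rw [smul_comm]
      rfl
    simp only [Submodule.coe_smul, Pi.smul_apply, h, RingHom.id_apply]
    rw [integral_smul, smul_comm]

end

section
variable {W : Type u} [NormedAddCommGroup W] [NormedSpace ℝ W]
  {W' : Type u} [NormedAddCommGroup W'] [NormedSpace ℝ W']

/-- The determinant form of the basis `c`, as an alternating form in those of its arguments
which correspond under `e` to `Fin p`; the others are filled with `w`. -/
noncomputable def partialDet {p q n : ℕ} (c : Basis (Fin n) ℝ W) (e : Fin p ⊕ Fin q ≃ Fin n)
    (w : Fin q → W) : W [⋀^Fin p]→L[ℝ] ℝ where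
  toFun v := c.det fun i => Sum.elim v w (e.symm i)
  map_update_add' v i x y := by
    have h : ∀ z, (fun l => Sum.elim (Function.update v i z) w (e.symm l))
        = Function.update (fun l => Sum.elim v w (e.symm l)) (e (Sum.inl i)) z := by
      intro z
      funext l
      rw [Sum.elim_update_left]
      by_cases hl : l = e (Sum.inl i)
      · subst hl; simp
      · have : e.symm l ≠ Sum.inl i := fun h => hl (by rw [← h]; simp)
        simp [Function.update_of_ne hl, Function.update_of_ne this]
    have := c.det.map_update_add (fun l => Sum.elim v w (e.symm l)) (e (Sum.inl i)) x y
    rw [← h, ← h, ← h] at this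
    convert this
  map_update_smul' v i a x := by
    have h : ∀ z, (fun l => Sum.elim (Function.update v i z) w (e.symm l))
        = Function.update (fun l => Sum.elim v w (e.symm l)) (e (Sum.inl i)) z := by
      intro z
      funext l
      rw [Sum.elim_update_left]
      by_cases hl : l = e (Sum.inl i)
      · subst hl; simp
      · have : e.symm l ≠ Sum.inl i := fun h => hl (by rw [← h]; simp)
        simp [Function.update_of_ne hl, Function.update_of_ne this]
    have := c.det.map_update_smul (fun l => Sum.elim v w (e.symm l)) (e (Sum.inl i)) a x
    rw [← h, ← h] at this
    convert this
  map_eq_zero_of_eq' v i j hv hij :=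
    c.det.map_eq_zero_of_eq (i := e (Sum.inl i)) (j := e (Sum.inl j)) _ (by simpa using hv)
      (by simpa using hij)
  cont := by
    have : FiniteDimensional ℝ W := c.finiteDimensional_of_finite
    simp only [Basis.det_apply]
    refine Continuous.matrix_det ?_
    refine continuous_matrix fun i l => ?_
    have hc : Continuous (c.coord i) := (c.coord i).continuous_of_finiteDimensional
    refine hc.comp (g := fun x => c.coord i x) ?_
    rcases h : e.symm l with r | r
    · simpa [h] using continuous_apply r
    · simpa [h] using continuous_const

/-- The dual of the Hodge star, for dual bases `c` of `W` and `c'` of `W'`.  Thinking of alternating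
`q`-forms on `W'` as elements of `Λ^q W` and writing `vol` for the determinant of `c`, it sends
`u` to the `p`-form `v ↦ vol (v ∧ u)` on `W`; the equivalence `e` says which positions of the
`n`-fold wedge product are occupied by `v` and which by `u`. -/
noncomputable def hodge {p q n : ℕ} (c : Basis (Fin n) ℝ W) (c' : Basis (Fin n) ℝ W')
    (e : Fin p ⊕ Fin q ≃ Fin n) :
    (W' [⋀^Fin q]→L[ℝ] ℂ) →L[ℂ] (W [⋀^Fin p]→L[ℝ] ℂ) where
  toFun u := ∑ I : Fin q ↪o Fin n, u (fun i => c' (I i)) •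
    Complex.ofRealCLM.compContinuousAlternatingMap (partialDet c e fun i => c (I i))
  map_add' u u' := by
    rw [← Finset.sum_add_distrib]
    exact Finset.sum_congr rfl fun I _ => by ext v; simp [add_mul]
  map_smul' a u := by simp [Finset.smul_sum, mul_smul]
  cont := by
    refine continuous_finsetSum _ fun I _ => ?_
    have h : Continuous fun u : W' [⋀^Fin q]→L[ℝ] ℂ => u fun i => c' (I i) :=
      continuous_eval_const _
    exact h.smul continuous_const

end

section
variable {V : Type u} [NormedAddCommGroup V] [InnerProductSpace ℝ V]

/-- The metric projection onto a convex body. -/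
noncomputable def nearest (K : ConvexBody V) (x : V) : V :=
  (K.isCompact.exists_infDist_eq_dist K.nonempty x).choose

theorem nearest_mem (K : ConvexBody V) (x : V) : nearest K x ∈ K :=
  (K.isCompact.exists_infDist_eq_dist K.nonempty x).choose_spec.1

theorem infDist_eq_norm (K : ConvexBody V) (x : V) :
    Metric.infDist x (K : Set V) = ‖x - nearest K x‖ := by
  rw [← dist_eq_norm]
  exact (K.isCompact.exists_infDist_eq_dist K.nonempty x).choose_spec.2

theorem inner_nearest (K : ConvexBody V) (x w : V) (hw : w ∈ K) :
    inner ℝ (x - nearest K x) (w - nearest K x) ≤ 0 := by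
  refine (norm_eq_iInf_iff_real_inner_le_zero K.convex (nearest_mem K x)).1 ?_ w hw
  rw [← infDist_eq_norm, Metric.infDist_eq_iInf]
  simp [dist_eq_norm]

theorem lipschitz_nearest (K : ConvexBody V) : LipschitzWith 1 (nearest K) := by
  refine LipschitzWith.of_dist_le_mul fun x y => ?_
  rw [dist_eq_norm, dist_eq_norm, NNReal.coe_one, one_mul]
  have h1 := inner_nearest K x _ (nearest_mem K y)
  have h2 := inner_nearest K y _ (nearest_mem K x)
  set p := nearest K x
  set q := nearest K y
  have h3 : ‖p - q‖ ^ 2 ≤ inner ℝ (x - y) (p - q) := by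
    have e1 : inner ℝ (x - p) (q - p) = - inner ℝ (x - p) (p - q) := by
      rw [← inner_neg_right, neg_sub]
    rw [← real_inner_self_eq_norm_sq]
    have e2 : inner ℝ (x - y) (p - q) = inner ℝ (x - p) (p - q) + inner ℝ (p - q) (p - q)
        - inner ℝ (y - q) (p - q) := by
      rw [← inner_add_left, ← inner_sub_left]
      congr 1
      abel
    linarith
  have h4 := real_inner_le_norm (x - y) (p - q)
  by_contra hlt
  push Not at hlt
  nlinarith [norm_nonneg (x - y), norm_nonneg (p - q)]

variable [FiniteDimensional ℝ V]

/-- For `0 < dist(x, K)` consider `G(x) = (p(x), ⟨x - p(x), ·⟩)`, where `p` is the metric projection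
onto `K`.  A form `α` on `ℙ₊(V^*)` of degree `j` with values in `Λ^m V^*` is a translation invariant
form of bidegree `(m, j)` on `V × ℙ₊(V^*)`, the `V`-covectors being written first.  This is the
coefficient of the `n`-form `d(dist(·, K)) ∧ G^* α`, `n = m + j + 1`, relative to the basis `b`.
The maps involved are Lipschitz, hence differentiable almost everywhere. -/
noncomputable def normalCycleIntegrand {m j : ℕ} (b : OrthonormalBasis (Fin (m + (j + 1))) ℝ V)
    (α : StrongDual ℝ V → StrongDual ℝ V [⋀^Fin j]→L[ℝ] (V [⋀^Fin m]→L[ℝ] ℂ))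
    (K : ConvexBody V) (x : V) : ℂ :=
  ((m.factorial : ℂ) * j.factorial)⁻¹ * ∑ σ : Equiv.Perm (Fin (m + (j + 1))),
    ((Equiv.Perm.sign σ : ℤ) : ℂ) *
      (fderiv ℝ (fun y => Metric.infDist y (K : Set V)) x
        (b (σ (0 : Fin ((m + j) + 1)))) : ℝ) *
      α (innerSL ℝ (x - nearest K x))
        (fun i => fderiv ℝ (fun y => innerSL ℝ (y - nearest K y)) x
          (b (σ (Fin.succ (Fin.natAdd m i)))))
        (fun i => fderiv ℝ (nearest K) x (b (σ (Fin.succ (Fin.castAdd j i)))))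

variable [MeasurableSpace V] [BorelSpace V]

theorem integrable_normalCycleIntegrand {m j : ℕ} (b : OrthonormalBasis (Fin (m + (j + 1))) ℝ V)
    (α : projForms (StrongDual ℝ V) j (V [⋀^Fin m]→L[ℝ] ℂ)) (K : ConvexBody V) :
    IntegrableOn (normalCycleIntegrand b α.1 K)
      {x | Metric.infDist x (K : Set V) ∈ Set.Ioo 1 2} := by
  set A : Set V := {x | Metric.infDist x (K : Set V) ∈ Set.Ioo 1 2} with hA
  have hAo : IsOpen A := isOpen_Ioo.preimage (Metric.continuous_infDist_pt _)
  have hAb : Bornology.IsBounded A := by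
    obtain ⟨R, hR⟩ := K.isCompact.isBounded.exists_norm_le
    refine isBounded_iff_forall_norm_le.2 ⟨R + 2, fun x hx => ?_⟩
    have h1 := hR _ (nearest_mem K x)
    have h2 : ‖x - nearest K x‖ < 2 := by rw [← infDist_eq_norm]; exact hx.2
    have := norm_le_norm_add_norm_sub' x (nearest K x)
    linarith
  have hcp : Continuous (nearest K) := (lipschitz_nearest K).continuous
  have hcξ : Continuous (fun x : V => innerSL ℝ (x - nearest K x)) := by fun_prop
  have hα : ContinuousOn (fun x => α.1 (innerSL ℝ (x - nearest K x))) A := by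
    refine α.2.1.continuousOn.comp hcξ.continuousOn fun x hx => ?_
    intro h0
    have h1 : ‖x - nearest K x‖ = 0 := by
      rw [← innerSL_apply_norm (𝕜 := ℝ)]
      simpa using h0
    have := hx.1
    rw [infDist_eq_norm, h1] at this
    linarith
  obtain ⟨C, hC⟩ : ∃ C, ∀ x ∈ A, ‖α.1 (innerSL ℝ (x - nearest K x))‖ ≤ C := by
    have hcomp : IsCompact (Metric.closedBall (0 : StrongDual ℝ V) 2 \ Metric.ball 0 1) :=
      (isCompact_closedBall _ _).diff Metric.isOpen_ball
    obtain ⟨C, hC⟩ := hcomp.exists_bound_of_continuousOn (f := α.1)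
      (α.2.1.continuousOn.mono fun ξ hξ h0 => hξ.2 (by rw [h0]; simp))
    refine ⟨C, fun x hx => hC _ ?_⟩
    have h1 : ‖innerSL ℝ (x - nearest K x)‖ = Metric.infDist x (K : Set V) := by
      rw [innerSL_apply_norm, infDist_eq_norm]
    constructor
    · rw [mem_closedBall_zero_iff, h1]; exact hx.2.le
    · rw [mem_ball_zero_iff, h1]; exact not_lt.2 hx.1.le
  have hd : ∀ x, ‖fderiv ℝ (fun y => Metric.infDist y (K : Set V)) x‖ ≤ 1 := fun x => by
    simpa using norm_fderiv_le_of_lipschitz ℝ (x₀ := x) (Metric.lipschitz_infDist_pt (K : Set V))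
  have hp : ∀ x, ‖fderiv ℝ (nearest K) x‖ ≤ 1 := fun x => by
    simpa using norm_fderiv_le_of_lipschitz ℝ (x₀ := x) (lipschitz_nearest K)
  have hlξ : LipschitzWith 2 (fun x : V => innerSL ℝ (x - nearest K x)) := by
    refine LipschitzWith.of_dist_le_mul fun x y => ?_
    have h1 := (lipschitz_nearest K).dist_le_mul x y
    rw [dist_eq_norm, ← map_sub, innerSL_apply_norm]
    rw [dist_eq_norm, dist_eq_norm, NNReal.coe_one, one_mul] at h1
    have : x - nearest K x - (y - nearest K y) = (x - y) - (nearest K x - nearest K y) := by abel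
    rw [this, dist_eq_norm]
    have := norm_sub_le (x - y) (nearest K x - nearest K y)
    push_cast
    linarith
  have hξ : ∀ x, ‖fderiv ℝ (fun y => innerSL ℝ (y - nearest K y)) x‖ ≤ 2 := fun x => by
    simpa using norm_fderiv_le_of_lipschitz ℝ (x₀ := x) hlξ
  have hb : ∀ i, ‖b i‖ ≤ 1 := fun i => (b.norm_eq_one i).le
  unfold normalCycleIntegrand
  refine Integrable.const_mul (integrable_finsetSum _ fun σ _ => ?_) _
  have : IsFiniteMeasure (volume.restrict A) := ⟨by simpa using hAb.measure_lt_top⟩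
  have : ProperSpace V := FiniteDimensional.proper ℝ V
  have : ProperSpace (StrongDual ℝ V) := FiniteDimensional.proper ℝ _
  have : SecondCountableTopology V := inferInstance
  have : SecondCountableTopology (StrongDual ℝ V) := inferInstance
  have : SecondCountableTopologyEither V (StrongDual ℝ V [⋀^Fin j]→L[ℝ] V [⋀^Fin m]→L[ℝ] ℂ) :=
    ⟨Or.inl inferInstance⟩
  refine Integrable.of_bound ?_ (1 * 1 * (C * 2 ^ j * 1 ^ m)) ?_
  · have m1 : AEStronglyMeasurable (fun x => fderiv ℝ (fun y => Metric.infDist y (K : Set V)) x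
        (b (σ (0 : Fin ((m + j) + 1))))) (volume.restrict A) :=
      (measurable_fderiv_apply_const ℝ _ _).aestronglyMeasurable
    have m2 : AEStronglyMeasurable (fun x => fun i : Fin j =>
        fderiv ℝ (fun y => innerSL ℝ (y - nearest K y)) x
          (b (σ (Fin.succ (Fin.natAdd m i))))) (volume.restrict A) := by
      let : MeasurableSpace (StrongDual ℝ V) := borel _
      have : BorelSpace (StrongDual ℝ V) := ⟨rfl⟩
      exact (measurable_pi_lambda _ fun i => measurable_fderiv_apply_const ℝ _ _).aestronglyMeasurable
    have m3 : AEStronglyMeasurable (fun x => fun i : Fin m =>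
        fderiv ℝ (nearest K) x (b (σ (Fin.succ (Fin.castAdd j i))))) (volume.restrict A) :=
      (measurable_pi_lambda _ fun i => measurable_fderiv_apply_const ℝ _ _).aestronglyMeasurable
    have m4 := hα.aestronglyMeasurable hAo.measurableSet (μ := volume)
    have e1 : Continuous (fun z : (StrongDual ℝ V [⋀^Fin j]→L[ℝ] (V [⋀^Fin m]→L[ℝ] ℂ)) ×
        ((Fin j → StrongDual ℝ V) × (Fin m → V)) => z.1 z.2.1 z.2.2) :=
      (((continuous_fst.eval continuous_snd.fst)).eval continuous_snd.snd)
    have m5 := e1.comp_aestronglyMeasurable (m4.prodMk (m2.prodMk m3))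
    exact ((aestronglyMeasurable_const (b := ((Equiv.Perm.sign σ : ℤ) : ℂ))).mul
      (Complex.continuous_ofReal.comp_aestronglyMeasurable m1)).mul m5
  · refine (ae_restrict_iff' hAo.measurableSet).2 (Filter.Eventually.of_forall fun x hx => ?_)
    rw [norm_mul, norm_mul]
    have hC0 : 0 ≤ C := (norm_nonneg _).trans (hC x hx)
    gcongr
    · rcases Int.units_eq_one_or (Equiv.Perm.sign σ) with h | h <;> simp [h]
    · rw [Complex.norm_real]
      exact ((fderiv ℝ (fun y => Metric.infDist y (K : Set V)) x).le_of_opNorm_le_of_le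
        (hd x) (hb _)).trans (by simp)
    · refine (ContinuousAlternatingMap.le_opNorm_mul_pow_of_le (b := 1) _ ?_).trans ?_
      · exact (pi_norm_le_iff_of_nonneg zero_le_one).2 fun i =>
          ((fderiv ℝ (nearest K) x).le_of_opNorm_le_of_le (hp x) (hb _)).trans (by simp)
      · gcongr
        refine (ContinuousAlternatingMap.le_opNorm_mul_pow_of_le (b := 2) _ ?_).trans ?_
        · exact (pi_norm_le_iff_of_nonneg zero_le_two).2 fun i =>
            ((fderiv ℝ (fun y => innerSL ℝ (y - nearest K y)) x).le_of_opNorm_le_of_le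
              (hξ x) (hb _)).trans (by simp)
        · gcongr
          exact hC x hx
end

section
variable {V : Type u} [NormedAddCommGroup V] [InnerProductSpace ℝ V] [FiniteDimensional ℝ V]
  [MeasurableSpace V] [BorelSpace V]

/-- The smooth translation invariant valuation `K ↦ ∫_{nc(K)} α`, of degree `m`.
For each `s > 0` the map `x ↦ (p(x), [⟨x - p(x), ·⟩])` is an orientation preserving bi-Lipschitz
homeomorphism from the hypersurface `{dist(·, K) = s}` onto the normal cycle
`nc(K) ⊂ V × ℙ₊(V^*)`, so `∫_{nc(K)} α = ∫_{1 < dist(x, K) < 2} d(dist(·, K)) ∧ G^* α` by the coarea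
formula.  `V` is oriented by `b`; reversing the orientation changes the sign. -/
noncomputable def normalCycleValuation {m j : ℕ} (b : OrthonormalBasis (Fin (m + (j + 1))) ℝ V) :
    projForms (StrongDual ℝ V) j (V [⋀^Fin m]→L[ℝ] ℂ) →ₗ[ℂ] (ConvexBody V → ℂ) where
  toFun α K := ∫ x in {x | Metric.infDist x (K : Set V) ∈ Set.Ioo 1 2},
    normalCycleIntegrand b α.1 K x
  map_add' α β := by
    funext K
    simp only [Pi.add_apply]
    rw [← integral_add (integrable_normalCycleIntegrand b α K)
      (integrable_normalCycleIntegrand b β K)]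
    congr 1
    funext x
    simp [normalCycleIntegrand, mul_add, Finset.sum_add_distrib]
  map_smul' c α := by
    funext K
    simp only [Pi.smul_apply, RingHom.id_apply]
    rw [← integral_smul]
    congr 1
    funext x
    simp only [normalCycleIntegrand, Submodule.coe_smul, Pi.smul_apply,
      ContinuousAlternatingMap.smul_apply, smul_eq_mul, Finset.mul_sum]
    refine Finset.sum_congr rfl fun σ _ => ?_
    ring

/-- The space `Val_m^∞(V)` of smooth translation invariant valuations of degree `m`, where
`dim V = m + k`.  For `k = 0` these are the multiples of Lebesgue measure, for `k > 0` the
valuations given by integration over the normal cycle. -/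
noncomputable def smoothValuations : (m k : ℕ) → OrthonormalBasis (Fin (m + k)) ℝ V →
    Submodule ℂ (ConvexBody V → ℂ)
  | _, 0, _ => ℂ ∙ fun K : ConvexBody V => ((volume.real (K : Set V) : ℝ) : ℂ)
  | _, _ + 1, b => LinearMap.range (normalCycleValuation b)

/-- Continuity of a functional on `Val_m^∞(V)` for its natural topology: for `k = j + 1 > 0` this is
the quotient topology from the space of smooth `j`-forms on `ℙ₊(V^*)` with its `C^∞` topology.
For `k = 0` the space has dimension one. -/
def IsContinuousFunctional : (m k : ℕ) → (b : OrthonormalBasis (Fin (m + k)) ℝ V) →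
    (smoothValuations m k b →ₗ[ℂ] ℂ) → Prop
  | _, 0, _, _ => True
  | m, j + 1, b, φ => ∃ (N : ℕ) (C : ℝ),
      ∀ (α : projForms (StrongDual ℝ V) j (V [⋀^Fin m]→L[ℝ] ℂ)) (M : ℝ),
        (∀ i ≤ N, ∀ ξ : StrongDual ℝ V, ‖ξ‖ = 1 → ‖iteratedFDeriv ℝ i α.1 ξ‖ ≤ M) →
          ‖φ ((normalCycleValuation b).rangeRestrict α)‖ ≤ C * M

/-- Generalized valuations of degree `k` on the space `V` of dimension `m + k`: continuous linear
functionals on `Val_m^∞(V) ⊗ Dens(V)^*`, with `Dens(V)` trivialized by the Lebesgue measure. -/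
structure GeneralizedValuation (m k : ℕ) (b : OrthonormalBasis (Fin (m + k)) ℝ V) where
  /-- the functional -/
  toFun : smoothValuations m k b →ₗ[ℂ] ℂ
  /-- it is continuous -/
  continuous : IsContinuousFunctional m k b toFun

/-- The basis of `V^*` dual to `b`. -/
noncomputable def dualBasis {n : ℕ} (b : OrthonormalBasis (Fin n) ℝ V) :
    Basis (Fin n) ℝ (StrongDual ℝ V) :=
  b.toBasis.dualBasis.map LinearMap.toContinuousLinearMap

/-- The generalized form `S` of degree `m = n - k` on `ℙ₊(V^*)` with values in
`Λ^m V ⊗ Dens(V)` that is defined by `φ`: the functional `α ↦ φ (∫_{nc(·)} α)`. -/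
noncomputable def currentS {m j : ℕ} (b : OrthonormalBasis (Fin (m + (j + 1))) ℝ V)
    (φ : GeneralizedValuation m (j + 1) b) :
    projForms (StrongDual ℝ V) j (V [⋀^Fin m]→L[ℝ] ℂ) →ₗ[ℂ] ℂ :=
  φ.toFun ∘ₗ (normalCycleValuation b).rangeRestrict

/-- The generalized form `T = (-1)^{k(n-k)} *_{V^*} ∘ S` of degree `m = n - k` on `ℙ₊(V^*)` with
values in `Λ^k V^* ⊗ or(V)`. -/
noncomputable def currentT {m j : ℕ} (b : OrthonormalBasis (Fin (m + (j + 1))) ℝ V)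
    (φ : GeneralizedValuation m (j + 1) b) :
    projForms (StrongDual ℝ V) j (StrongDual ℝ V [⋀^Fin (j + 1)]→L[ℝ] ℂ) →ₗ[ℂ] ℂ :=
  (-1 : ℂ) ^ ((j + 1) * m) •
    (currentS b φ ∘ₗ projForms.postcomp (hodge b.toBasis (dualBasis b) finSumFinEquiv))

/-- The `0`-homogeneous current `τ` of a generalized valuation `φ` of degree `k`, a generalized form
of degree `m = n - k` on `V^*` with values in `Λ^k V^* ⊗ or(V)`.  For `k > 0` it is the
`0`-homogeneous extension `r^0 T` of `T`, given by `⟨r^0 T, η⟩ = ⟨T, π_* η⟩`.  For `k = 0` the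
valuation is `c χ` with `χ` the Euler characteristic and `c` its pairing with the Lebesgue
measure, and `τ = c δ_0`. -/
noncomputable def zeroHomogeneousCurrent : (m k : ℕ) → (b : OrthonormalBasis (Fin (m + k)) ℝ V) →
    GeneralizedValuation m k b →
    testForms (StrongDual ℝ V) k (StrongDual ℝ V [⋀^Fin k]→L[ℝ] ℂ) →ₗ[ℂ] ℂ
  | _, 0, _, φ =>
    { toFun := fun η => φ.toFun ⟨_, Submodule.mem_span_singleton_self _⟩ * η.1 0 ![] ![]
      map_add' := fun η η' => by simp [mul_add]
      map_smul' := fun c η => by simp [mul_left_comm] }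
  | m, j + 1, b, φ => currentT b φ ∘ₗ fiberIntegral m j

/-- The generalized form `*_V ∘ τ` of degree `m` with values in `Λ^m V ⊗ Dens(V)` that corresponds
to `τ` under the Hodge star `Λ^k V^* ≃ Λ^m V ⊗ Λ^n V^*`. -/
noncomputable def barCurrent {m k : ℕ} (b : OrthonormalBasis (Fin (m + k)) ℝ V)
    (τ : testForms (StrongDual ℝ V) k (StrongDual ℝ V [⋀^Fin k]→L[ℝ] ℂ) →ₗ[ℂ] ℂ) :
    testForms (StrongDual ℝ V) k (V [⋀^Fin m]→L[ℝ] ℂ) →ₗ[ℂ] ℂ :=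
  τ ∘ₗ testForms.postcomp
    (hodge (dualBasis b) b.toBasis (finSumFinEquiv.trans (finCongr (add_comm k m))))

/-- The test form `g ψ ⊗ f`. -/
noncomputable def tensorTest {W : Type u} [NormedAddCommGroup W] [NormedSpace ℝ W]
    {F : Type u} [NormedAddCommGroup F] [NormedSpace ℝ F] [NormedSpace ℂ F] [IsScalarTower ℝ ℂ F]
    {k : ℕ} (ψ : W [⋀^Fin k]→L[ℝ] ℂ) (f : F) : testFunctions W →ₗ[ℂ] testForms W k F where
  toFun g := ⟨fun ξ => g.1 ξ • ((ContinuousLinearMap.toSpanSingleton ℂ f).restrictScalars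
      ℝ).compContinuousAlternatingMap ψ,
    g.2.1.smul contDiff_const, g.2.2.smul_right⟩
  map_add' g g' := by ext1; funext ξ; simp [add_smul]
  map_smul' c g := by ext1; funext ξ; simp [mul_smul]

/-- The form `ζ_1 ∧ ⋯ ∧ ζ_m` on `V`. -/
noncomputable def wedge {m : ℕ} (ζ : Fin m → StrongDual ℝ V) : V [⋀^Fin m]→L[ℝ] ℂ :=
  Complex.ofRealCLM.compContinuousAlternatingMap
    { (Matrix.detRowAlternating (R := ℝ) (n := Fin m)).compLinearMap
        (LinearMap.pi fun i => (ζ i).toLinearMap) with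
      cont := by
        refine Continuous.matrix_det (A := fun v : Fin m → V => fun l i => ζ i (v l)) ?_
        exact continuous_matrix fun l i => (ζ i).continuous.comp (continuous_apply l) }

theorem wedge_apply {m : ℕ} (ζ : Fin m → StrongDual ℝ V) (v : Fin m → V) :
    wedge ζ v = (Matrix.det (Matrix.of fun i l => ζ i (v l)) : ℝ) := by
  rw [← Matrix.det_transpose]; rfl

/-- The complex line of densities on the `n`-dimensional space `V`. -/
def Dens (V : Type*) [AddCommGroup V] [Module ℝ V] (n : ℕ) : Submodule ℂ (⋀[ℝ]^n V → ℂ) where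
  carrier := {μ | ∀ (t : ℝ) (w : ⋀[ℝ]^n V), μ (t • w) = (|t| : ℝ) * μ w}
  zero_mem' := by simp
  add_mem' hμ hν t w := by simp [hμ t w, hν t w, mul_add]
  smul_mem' c μ hμ t w := by simp [hμ t w, mul_left_comm]

/-- The density that takes the value `1` on the wedge product of the basis `b`. -/
noncomputable def lebesgueDens {n : ℕ} (b : Basis (Fin n) ℝ V) : Dens V n :=
  ⟨fun w => (|exteriorPower.alternatingMapLinearEquiv b.det w| : ℝ), fun t w => by
    simp [abs_mul]⟩

/-- A generalized form of degree `m` on `V^*` with values in `Λ^m V ⊗ Dens(V)`, considered as a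
distribution on `V^*` with values in `Λ^m V ⊗ Λ^m V ⊗ Dens(V)`; the first factor `Λ^m V` is the
one of the `m`-covectors of the manifold `V^*`, the second one that of the values.  The test density
on `V^*` is `g` times the Lebesgue measure of the basis dual to `b`.  The components of the value
relative to the basis of wedge products `b_I ⊗ b_J` are obtained by pairing with `g ψ_I ⊗ b_J^*`,
where `b_I^*` is the dual basis of `Λ^m V^*` and the form `ψ_I` of degree `k` on `V^*` is determined
by `β ∧ ψ_I = ⟨β, b_I^*⟩ vol` for all `β` in `Λ^m V`. -/
noncomputable def toTensorDistribution {m k : ℕ} (b : OrthonormalBasis (Fin (m + k)) ℝ V)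
    (τ : testForms (StrongDual ℝ V) k (V [⋀^Fin m]→L[ℝ] ℂ) →ₗ[ℂ] ℂ) :
    testFunctions (StrongDual ℝ V) →ₗ[ℝ]
      (⋀[ℝ]^m V ⊗[ℝ] ⋀[ℝ]^m V) ⊗[ℝ] Dens V (m + k) :=
  ∑ I : Fin m ↪o Fin (m + k), ∑ J : Fin m ↪o Fin (m + k),
    TensorProduct.mk ℝ (⋀[ℝ]^m V ⊗[ℝ] ⋀[ℝ]^m V) (Dens V (m + k))
      (exteriorPower.ιMulti ℝ m (fun i => b (I i)) ⊗ₜ[ℝ]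
        exteriorPower.ιMulti ℝ m (fun i => b (J i))) ∘ₗ
      (LinearMap.toSpanSingleton ℂ (Dens V (m + k)) (lebesgueDens b.toBasis) ∘ₗ τ ∘ₗ
        tensorTest
          (hodge (dualBasis b) b.toBasis ((Equiv.sumComm _ _).trans finSumFinEquiv)
            (wedge fun i => dualBasis b (I i)))
          (wedge fun i => dualBasis b (J i))).restrictScalars ℝ

/-- The space `Sym^2 E` of symmetric tensors in `E ⊗ E`. -/
def symSq (E : Type*) [AddCommGroup E] [Module ℝ E] : Submodule ℝ (E ⊗[ℝ] E) :=
  LinearMap.eqLocus (TensorProduct.comm ℝ E E).toLinearMap LinearMap.id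

/-- The subspace `Sym^2(Λ^m V) ⊗ Dens(V)` of `Λ^m V ⊗ Λ^m V ⊗ Dens(V)`, where `n = dim V`. -/
noncomputable def symSqDens (V : Type*) [AddCommGroup V] [Module ℝ V] (m n : ℕ) :
    Submodule ℝ ((⋀[ℝ]^m V ⊗[ℝ] ⋀[ℝ]^m V) ⊗[ℝ] Dens V n) :=
  LinearMap.range ((symSq (⋀[ℝ]^m V)).subtype.rTensor (Dens V n))

end

/-! The component of the current at `b_I ⊗ b_J` is its pairing with the test form `g ψ_I ⊗ b_J^*`.
The two Hodge stars cancel up to a sign that does not depend on `I` and `J` (`hodge_partialDet`),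
and fibre integration contracts `ψ_I` with `ξ` and multiplies by a radial moment `h(ξ)` of `g`
(`fiberIntegral_tensorTest_apply`). For `k > 0` the component is therefore, up to a common sign, the
value of `φ` on the valuation given by the form `h(ξ) (ξ ⌟ ψ_I) ⊗ b_J^*`. The claim is that
exchanging `I` and `J` leaves this valuation itself unchanged (`normalCycleValuation_symm`).

Let `p` be the metric projection onto `K`. At a point `x` where `p` is differentiable, put `A =
Dp(x)` and `ξ = x - p(x)`. Then `A` is symmetric, because `x ↦ x - p(x)` is the gradient of half the
squared distance to `K`, and `A ξ = 0`, because `p` is constant along normal rays. The integrand is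
`h(ξ)` times the `n`-form `L ∧ ⟨⋆b_I, ξ ∧ Λ^j(1 - A)⟩ ∧ ⟨b_J, Λ^m A⟩` with `L` the differential of
the distance, so symmetry becomes linear algebra, valid for every linear form `L`
(`sum_perm_symm_of_isSymmetric`).

Evaluate this form on an orthonormal eigenbasis `a` of `A`. In a summand where `A` acts on `a_s` and
`1 - A` on `a_t`, the last factor is `∏ λ_s ⟨b_J, a_s⟩`. If the product is nonzero, the vectors
`a_s` are orthogonal to `ξ`, which lies in the kernel of `A`, and to `(1 - A) a_t`, a multiple of
`a_t`. The determinant of `b_I, ξ, (1 - A) a_t` then splits off `⟨b_I, a_s⟩`, and what remains does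
not involve `I`. Each summand is a common factor times `⟨b_I, a_s⟩ ⟨b_J, a_s⟩`. -/

section
-- Determinants and alternating sums in a change of basis
variable {V : Type u} [NormedAddCommGroup V] [InnerProductSpace ℝ V]

/-- Expansion of a determinant whose last columns are orthogonal to the first vectors of an
orthonormal basis. -/
theorem OrthonormalBasis.det_sumElim_eq_mul {n p q : ℕ} (b : OrthonormalBasis (Fin n) ℝ V)
    (b' : OrthonormalBasis (Fin p ⊕ Fin q) ℝ V) (e : Fin p ⊕ Fin q ≃ Fin n)
    (w : Fin p → V) (z : Fin q → V) (hz : ∀ i r, inner ℝ (b' (Sum.inl i)) (z r) = 0) :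
    b.toBasis.det (fun i => Sum.elim w z (e.symm i)) =
      (Matrix.of fun i l => inner ℝ (b' (Sum.inl i)) (w l)).det *
        b.toBasis.det (fun i => Sum.elim (fun i => b' (Sum.inl i)) z (e.symm i)) := by
  -- In the basis `b'` the matrix is block triangular: by `hz` the vectors `z` have no component
  -- along the first `p` basis vectors.
  have hmat : ∀ w : Fin p → V, b'.toBasis.det (Sum.elim w z) =
      (Matrix.of fun i l => inner ℝ (b' (Sum.inl i)) (w l)).det *
        (Matrix.of fun i l => inner ℝ (b' (Sum.inr i)) (z l)).det := by
    intro w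
    rw [Basis.det_apply, ← Matrix.det_fromBlocks_zero₁₂ _
      (Matrix.of fun i l => inner ℝ (b' (Sum.inr i)) (w l))]
    congr 1
    ext i l
    rcases i with i | i <;> rcases l with l | l <;>
      simp [Basis.toMatrix_apply, OrthonormalBasis.repr_apply_apply, hz]
  -- Taking the first vectors of `b'` for `w` makes the Gram block trivial; this identifies the
  -- remaining factor, which does not depend on `w`.
  have hone : (Matrix.of fun i l => inner ℝ (b' (Sum.inl i)) (b' (Sum.inl l))) =
      (1 : Matrix (Fin p) (Fin p) ℝ) := by
    ext i l
    simp [orthonormal_iff_ite.1 b'.orthonormal, Matrix.one_apply]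
  have hb : ∀ w : Fin p → V, b.toBasis.det (fun i => Sum.elim w z (e.symm i)) =
      (b.toBasis.reindex e.symm).det b'.toBasis * b'.toBasis.det (Sum.elim w z) := by
    intro w
    have h := AlternatingMap.eq_smul_basis_det b'.toBasis (b.toBasis.reindex e.symm).det
    have h2 := congrArg (fun f => f (Sum.elim w z)) h
    simp only [Basis.det_reindex, AlternatingMap.smul_apply, smul_eq_mul] at h2 ⊢
    rw [← h2]
    rfl
  rw [hb, hb, hmat, hmat (fun i => b' (Sum.inl i)), hone, Matrix.det_one]
  ring

/-- The sum `∑ σ, sign σ * (Q ⊗ P ⊗ ℓ) (v ∘ σ)` depends on the basis `v` only through a factor. -/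
theorem exists_sum_perm_eq_mul {ι κ μ ν : Type*} [Fintype ι] [DecidableEq ι] [Fintype κ]
    [Fintype μ] [Fintype ν]
    (E : (κ ⊕ μ) ⊕ ν ≃ ι) (b b' : Basis ι ℝ V) :
    ∃ c : ℝ, ∀ (Q : MultilinearMap ℝ (fun _ : κ => V) ℝ) (P : MultilinearMap ℝ (fun _ : μ => V) ℝ)
      (L : MultilinearMap ℝ (fun _ : ν => V) ℝ),
      ∑ σ : Equiv.Perm ι, (Equiv.Perm.sign σ : ℝ) *
        (Q (fun i => b (σ (E (Sum.inl (Sum.inl i))))) *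
          P (fun i => b (σ (E (Sum.inl (Sum.inr i))))) * L (fun i => b (σ (E (Sum.inr i))))) =
      c * ∑ σ : Equiv.Perm ι, (Equiv.Perm.sign σ : ℝ) *
        (Q (fun i => b' (σ (E (Sum.inl (Sum.inl i))))) *
          P (fun i => b' (σ (E (Sum.inl (Sum.inr i))))) * L (fun i => b' (σ (E (Sum.inr i))))) := by
  refine ⟨b'.det b, fun Q P L => ?_⟩
  -- The sum is the alternatization of `Q ⊗ P ⊗ L`. Being of top degree, it is a multiple of
  -- `b'.det`, whence the factor `b'.det b`.
  let N : MultilinearMap ℝ (fun _ : ι => V) ℝ :=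
    ((LinearMap.mul' ℝ ℝ).compMultilinearMap
      (((LinearMap.mul' ℝ ℝ).compMultilinearMap (Q.domCoprod P)).domCoprod L)).domDomCongr E
  have hN : ∀ v : ι → V, MultilinearMap.alternatization N v =
      ∑ σ : Equiv.Perm ι, (Equiv.Perm.sign σ : ℝ) *
        (Q (fun i => v (σ (E (Sum.inl (Sum.inl i))))) *
          P (fun i => v (σ (E (Sum.inl (Sum.inr i))))) * L (fun i => v (σ (E (Sum.inr i))))) := by
    intro v
    rw [MultilinearMap.alternatization_apply]
    refine Finset.sum_congr rfl fun σ _ => ?_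
    rw [Units.smul_def, zsmul_eq_mul]
    simp [N]
  rw [← hN, ← hN]
  have := congrArg (fun f => f b) (AlternatingMap.eq_smul_basis_det b' (MultilinearMap.alternatization N))
  simp only [AlternatingMap.smul_apply, smul_eq_mul] at this
  rw [this, mul_comm]

end

/-! ### The symmetry for a symmetric endomorphism -/

section
variable {V : Type u} [NormedAddCommGroup V] [InnerProductSpace ℝ V]

/-- For a symmetric map `A` with `A ξ = 0` the `n`-form
`L ∧ ⟨⋆b_I, ξ ∧ Λ^j(1 - A) ·⟩ ∧ ⟨b_J, Λ^m A ·⟩` is symmetric in `I` and `J`. -/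
theorem sum_perm_symm_of_isSymmetric [FiniteDimensional ℝ V] {m j : ℕ}
    (b : OrthonormalBasis (Fin (m + (j + 1))) ℝ V)
    (e : Fin m ⊕ Fin (j + 1) ≃ Fin (m + (j + 1))) (A : V →ₗ[ℝ] V) (hA : A.IsSymmetric) (ξ : V)
    (hξ : A ξ = 0) (L : V →ₗ[ℝ] ℝ) (E : (Fin m ⊕ Fin j) ⊕ Fin 1 ≃ Fin (m + (j + 1)))
    (I J : Fin m → Fin (m + (j + 1))) :
    ∑ σ : Equiv.Perm (Fin (m + (j + 1))), (Equiv.Perm.sign σ : ℝ) *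
      ((Matrix.of fun i l => inner ℝ (b (J i)) (A (b (σ (E (Sum.inl (Sum.inl l))))))).det *
        b.toBasis.det (fun i => Sum.elim (fun i => b (I i)) (Fin.cons ξ fun i =>
          b (σ (E (Sum.inl (Sum.inr i)))) - A (b (σ (E (Sum.inl (Sum.inr i))))) ) (e.symm i)) *
        L (b (σ (E (Sum.inr 0))))) =
    ∑ σ : Equiv.Perm (Fin (m + (j + 1))), (Equiv.Perm.sign σ : ℝ) *
      ((Matrix.of fun i l => inner ℝ (b (I i)) (A (b (σ (E (Sum.inl (Sum.inl l))))))).det *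
        b.toBasis.det (fun i => Sum.elim (fun i => b (J i)) (Fin.cons ξ fun i =>
          b (σ (E (Sum.inl (Sum.inr i)))) - A (b (σ (E (Sum.inl (Sum.inr i))))) ) (e.symm i)) *
        L (b (σ (E (Sum.inr 0))))) := by
  have hn : finrank ℝ V = m + (j + 1) := by
    rw [finrank_eq_card_basis b.toBasis, Fintype.card_fin]
  let a := hA.eigenvectorBasis hn
  let lam := hA.eigenvalues hn
  have ha : ∀ i, A (a i) = lam i • a i := fun i => hA.apply_eigenvectorBasis hn i
  -- The factor `c` is the same for all `I` and `J`, so the sums may be compared on the eigenbasis,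
  -- where they agree term by term.
  obtain ⟨c, hc⟩ := exists_sum_perm_eq_mul E b.toBasis a.toBasis
  let Q (J : Fin m → Fin (m + (j + 1))) : MultilinearMap ℝ (fun _ : Fin m => V) ℝ :=
    (Matrix.detRowAlternating (R := ℝ) (n := Fin m)).toMultilinearMap.compLinearMap
      fun _ => LinearMap.pi fun i => (innerₛₗ ℝ (b (J i))).comp A
  let P (I : Fin m → Fin (m + (j + 1))) : MultilinearMap ℝ (fun _ : Fin j => V) ℝ :=
    ((((b.toBasis.det.toMultilinearMap).domDomCongr e.symm).currySum
      (fun i => b (I i))).curryLeft ξ).compLinearMap fun _ => LinearMap.id - A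
  have hQ : ∀ J v, Q J v = (Matrix.of fun i l => inner ℝ (b (J i)) (A (v l))).det := by
    intro J v
    rw [← Matrix.det_transpose]
    rfl
  have hP : ∀ I v, P I v = b.toBasis.det (fun i => Sum.elim (fun i => b (I i))
      (Fin.cons ξ fun i => v i - A (v i)) (e.symm i)) := by
    intro I v
    rfl
  have key := fun I J => hc (Q J) (P I) (MultilinearMap.ofSubsingleton ℝ V ℝ (0 : Fin 1) L)
  simp only [hQ, hP, OrthonormalBasis.coe_toBasis, MultilinearMap.ofSubsingleton_apply_apply] at key
  rw [key I J, key J I]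
  congr 1
  refine Finset.sum_congr rfl fun σ _ => ?_
  congr 2
  set s : Fin m → Fin (m + (j + 1)) := fun i => σ (E (Sum.inl (Sum.inl i))) with hs
  set t : Fin j → Fin (m + (j + 1)) := fun i => σ (E (Sum.inl (Sum.inr i))) with ht
  have hst : ∀ i r, s i ≠ t r := fun i r h => by simp [hs, ht] at h
  have hdet : ∀ J : Fin m → Fin (m + (j + 1)),
      (Matrix.of fun i l => inner ℝ (b (J i)) (A (a (s l)))).det =
        (∏ l, lam (s l)) * (Matrix.of fun i l => inner ℝ (a (s i)) (b (J l))).det := by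
    intro J
    rw [← Matrix.det_transpose (Matrix.of fun i l => inner ℝ (a (s i)) (b (J l))),
      ← Matrix.det_mul_row]
    congr 1
    ext i l
    simp [ha, inner_smul_right, real_inner_comm]
  change (Matrix.of fun i l => inner ℝ (b (J i)) (A (a (s l)))).det * b.toBasis.det (fun i =>
      Sum.elim (fun i => b (I i)) (Fin.cons ξ fun i => a (t i) - A (a (t i))) (e.symm i)) =
    (Matrix.of fun i l => inner ℝ (b (I i)) (A (a (s l)))).det * b.toBasis.det (fun i =>
      Sum.elim (fun i => b (J i)) (Fin.cons ξ fun i => a (t i) - A (a (t i))) (e.symm i))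
  rw [hdet, hdet]
  -- If an eigenvalue `λ_s` vanishes, both sides are zero. Otherwise all `a_s` are orthogonal to the
  -- kernel of `A`, in particular to `ξ`.
  by_cases h0 : ∏ l, lam (s l) = 0
  · simp [h0]
  · have hlam : ∀ l, lam (s l) ≠ 0 := fun l h =>
      h0 (Finset.prod_eq_zero (Finset.mem_univ l) h)
    let E1 : Fin j ⊕ Fin 1 ≃ Fin (j + 1) := finSumFinEquiv
    -- Reorders the eigenbasis so that the `a_s` form the first block; the `a_t` and the vector fed
    -- to `L` fill the second.
    let F : Fin (m + (j + 1)) ≃ Fin m ⊕ Fin (j + 1) :=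
      ((E.trans σ).symm.trans (Equiv.sumAssoc _ _ _)).trans (Equiv.sumCongr (Equiv.refl _) E1)
    have hF : ∀ i, (a.reindex F) (Sum.inl i) = a (s i) := by
      intro i
      rw [OrthonormalBasis.reindex_apply]
      rfl
    have hz : ∀ (i : Fin m) (r : Fin (j + 1)), inner ℝ ((a.reindex F) (Sum.inl i))
        ((Fin.cons ξ fun i => a (t i) - A (a (t i)) : Fin (j + 1) → V) r) = 0 := by
      intro i r
      rw [hF]
      refine Fin.cases ?_ (fun r => ?_) r
      · rw [Fin.cons_zero]
        have h1 : inner ℝ (A (a (s i))) ξ = 0 := by rw [hA, hξ, inner_zero_right]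
        rw [ha, inner_smul_left] at h1
        exact (mul_eq_zero.1 h1).resolve_left (hlam i)
      · rw [Fin.cons_succ, ha, inner_sub_right, inner_smul_right,
          orthonormal_iff_ite.1 a.orthonormal, if_neg (hst i r)]
        simp
    have hdI := fun I : Fin m → Fin (m + (j + 1)) =>
      OrthonormalBasis.det_sumElim_eq_mul b (a.reindex F) e (fun i => b (I i)) _ hz
    simp only [hF] at hdI
    rw [hdI I, hdI J]
    ring

end

/-! ### The differential of the metric projection -/

section
variable {V : Type u} [NormedAddCommGroup V] [InnerProductSpace ℝ V]

/-- The moved point is `p + (1 + t)(x - p)`, on the ray from `p = p(x)` through `x`. If `q` is its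
projection, the obtuse angle inequalities at `p` and `q` give `‖p - q‖² ≤ (1 + t) ⟨x - p, q - p⟩ ≤
0`. -/
theorem nearest_add_smul_sub (K : ConvexBody V) (x : V) (t : ℝ) (ht : -1 ≤ t) :
    nearest K (x + t • (x - nearest K x)) = nearest K x := by
  have h1 := inner_nearest K x _ (nearest_mem K (x + t • (x - nearest K x)))
  have h2 := inner_nearest K (x + t • (x - nearest K x)) _ (nearest_mem K x)
  set p := nearest K x
  set q := nearest K (x + t • (x - p))
  have h3 : inner ℝ (x + t • (x - p) - q) (p - q) =
      - ((1 + t) * inner ℝ (x - p) (q - p)) + ‖p - q‖ ^ 2 := by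
    have e1 : x + t • (x - p) - q = (1 + t) • (x - p) + (p - q) := by module
    rw [e1, inner_add_left, inner_smul_left, ← neg_sub q p, inner_neg_right, inner_neg_neg, norm_neg,
      real_inner_self_eq_norm_sq]
    simp
  have h4 : ‖p - q‖ ^ 2 ≤ 0 := by nlinarith
  have h5 : ‖p - q‖ = 0 := by nlinarith [norm_nonneg (p - q)]
  exact (sub_eq_zero.1 (norm_eq_zero.1 h5)).symm

theorem fderiv_nearest_apply_sub (K : ConvexBody V) (x : V)
    (hx : DifferentiableAt ℝ (nearest K) x) : fderiv ℝ (nearest K) x (x - nearest K x) = 0 := by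
  have h1 : HasDerivAt (fun t : ℝ => nearest K (x + t • (x - nearest K x)))
      (fderiv ℝ (nearest K) x (x - nearest K x)) 0 := by
    have h2 : HasDerivAt (fun t : ℝ => x + t • (x - nearest K x)) (x - nearest K x) 0 := by
      simpa using ((hasDerivAt_id (0 : ℝ)).smul_const (x - nearest K x)).const_add x
    exact HasFDerivAt.comp_hasDerivAt (0 : ℝ) (by simpa using hx.hasFDerivAt) h2
  have h3 : (fun t : ℝ => nearest K (x + t • (x - nearest K x))) =ᶠ[nhds 0]
      fun _ => nearest K x := by
    filter_upwards [lt_mem_nhds (show (-1 : ℝ) < 0 by norm_num)] with t ht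
    exact nearest_add_smul_sub K x t ht.le
  exact h1.unique ((hasDerivAt_const 0 _).congr_of_eventuallyEq h3)

theorem norm_sub_nearest_le (K : ConvexBody V) (x w : V) (hw : w ∈ K) :
    ‖x - nearest K x‖ ≤ ‖x - w‖ := by
  rw [← infDist_eq_norm, ← dist_eq_norm]
  exact Metric.infDist_le_dist_of_mem hw

/-- Half the squared distance to a convex body has gradient `x - p(x)`. -/
theorem hasFDerivAt_half_sq_norm_sub_nearest (K : ConvexBody V) (x : V) :
    HasFDerivAt (fun y => ‖y - nearest K y‖ ^ 2 / 2) (innerSL ℝ (x - nearest K x)) x := by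
  -- The point `p(x)` competes with `p(y)` in the minimization of the distance to `y`.
  have upper : ∀ x y : V, ‖y - nearest K y‖ ^ 2 / 2 ≤
      ‖x - nearest K x‖ ^ 2 / 2 + inner ℝ (x - nearest K x) (y - x) + ‖y - x‖ ^ 2 / 2 := by
    intro x y
    have h1 := norm_sub_nearest_le K y _ (nearest_mem K x)
    have h2 : ‖y - nearest K x‖ ^ 2 = ‖x - nearest K x‖ ^ 2 +
        2 * inner ℝ (x - nearest K x) (y - x) + ‖y - x‖ ^ 2 := by
      rw [← norm_add_sq_real]
      congr 2
      abel
    nlinarith [norm_nonneg (y - nearest K y)]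
  have hO : (fun y => ‖y - nearest K y‖ ^ 2 / 2 -
      (‖x - nearest K x‖ ^ 2 / 2 + innerSL ℝ (x - nearest K x) (y - x))) =O[nhds x]
        fun y => ‖y - x‖ ^ 2 := by
    -- The lower bound is `upper` with `x` and `y` exchanged, where replacing `y - p(y)` by `x -
    -- p(x)` costs only `O(‖y - x‖²)` because `p` is 1-Lipschitz. The constant `2` is generous.
    refine Asymptotics.IsBigO.of_bound 2 (Filter.Eventually.of_forall fun y => ?_)
    have h1 := upper x y
    have h2 := upper y x
    have h3 : inner ℝ (y - nearest K y) (x - y) = - inner ℝ (x - nearest K x) (y - x)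
        - ‖y - x‖ ^ 2 + inner ℝ (nearest K y - nearest K x) (y - x) := by
      have e1 : y - nearest K y = (x - nearest K x) + (y - x) - (nearest K y - nearest K x) := by
        abel
      rw [← neg_sub y x, inner_neg_right, e1, inner_sub_left, inner_add_left,
        real_inner_self_eq_norm_sq]
      ring
    have h4 : inner ℝ (nearest K y - nearest K x) (y - x) ≤ ‖y - x‖ ^ 2 := by
      refine (real_inner_le_norm _ _).trans ?_
      have := (lipschitz_nearest K).dist_le_mul y x
      rw [dist_eq_norm, dist_eq_norm, NNReal.coe_one, one_mul] at this
      nlinarith [norm_nonneg (y - x)]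
    have h5 : -(inner ℝ (nearest K y - nearest K x) (y - x)) ≤ ‖y - x‖ ^ 2 := by
      rw [← inner_neg_left]
      refine (real_inner_le_norm _ _).trans ?_
      have := (lipschitz_nearest K).dist_le_mul y x
      rw [dist_eq_norm, dist_eq_norm, NNReal.coe_one, one_mul] at this
      rw [norm_neg]
      nlinarith [norm_nonneg (y - x)]
    rw [norm_sub_rev x y] at h2
    rw [innerSL_apply_apply, Real.norm_eq_abs, norm_pow, norm_norm, abs_le]
    constructor <;> nlinarith
  have h0 := hO.hasFDerivAt (𝕜 := ℝ) one_lt_two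
  have h1 : HasFDerivAt (fun y => ‖x - nearest K x‖ ^ 2 / 2 + innerSL ℝ (x - nearest K x) (y - x))
      (innerSL ℝ (x - nearest K x)) x := by
    refine HasFDerivAt.const_add _ ?_
    exact (innerSL ℝ (x - nearest K x)).hasFDerivAt.comp x ((hasFDerivAt_id x).sub_const x)
  have h2 := h0.add h1
  rw [zero_add] at h2
  refine h2.congr_of_eventuallyEq (Filter.Eventually.of_forall fun y => ?_)
  simp

theorem hasFDerivAt_innerSL_sub_nearest (K : ConvexBody V) (x : V)
    (hx : DifferentiableAt ℝ (nearest K) x) :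
    HasFDerivAt (fun y => innerSL ℝ (y - nearest K y))
      ((innerSL ℝ).comp (ContinuousLinearMap.id ℝ V - fderiv ℝ (nearest K) x)) x :=
  (innerSL ℝ).hasFDerivAt.comp x ((hasFDerivAt_id x).sub hx.hasFDerivAt)

/-- The operator `1 - Dp(x)` represents the second derivative at `x` of half the squared distance.
That function is differentiable everywhere, so differentiability of its gradient at the single point
`x` suffices for symmetry. -/
theorem isSymmetric_fderiv_nearest (K : ConvexBody V) (x : V)
    (hx : DifferentiableAt ℝ (nearest K) x) :
    (fderiv ℝ (nearest K) x : V →ₗ[ℝ] V).IsSymmetric := by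
  intro v w
  have h := second_derivative_symmetric_of_eventually
    (Filter.Eventually.of_forall fun y => hasFDerivAt_half_sq_norm_sub_nearest K y)
    (hasFDerivAt_innerSL_sub_nearest K x hx) v w
  simp only [ContinuousLinearMap.comp_apply, innerSL_apply_apply, sub_apply,
    ContinuousLinearMap.id_apply, inner_sub_left] at h
  rw [real_inner_comm w v] at h
  simp only [ContinuousLinearMap.coe_coe]
  rw [real_inner_comm (fderiv ℝ (nearest K) x w) v]
  linarith

end

/-! ### Hodge stars in dual bases -/

section
variable {V : Type u} [NormedAddCommGroup V] [InnerProductSpace ℝ V] [FiniteDimensional ℝ V]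

theorem dualBasis_apply {n : ℕ} (b : OrthonormalBasis (Fin n) ℝ V) (i : Fin n) :
    dualBasis b i = innerSL ℝ (b i) := by
  ext v
  have : b.repr v i = inner ℝ (b i) v := b.repr_apply_apply v i
  simp [dualBasis, this]

theorem det_dualBasis_innerSL {n : ℕ} (b : OrthonormalBasis (Fin n) ℝ V) (v : Fin n → V) :
    (dualBasis b).det (fun i => innerSL ℝ (v i)) = b.toBasis.det v := by
  rw [Basis.det_apply, Basis.det_apply]
  congr 1
  ext i l
  rw [Basis.toMatrix_apply, Basis.toMatrix_apply]
  have h : innerSL ℝ (v l) = ∑ r, b.toBasis.repr (v l) r • dualBasis b r := by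
    conv_lhs => rw [← b.toBasis.sum_repr (v l), map_sum]
    refine Finset.sum_congr rfl fun r _ => ?_
    rw [dualBasis_apply, OrthonormalBasis.coe_toBasis]
    ext w
    simp
  rw [h, Basis.repr_sum_self]

theorem wedge_dualBasis_apply [MeasurableSpace V] [BorelSpace V] {m n : ℕ}
    (b : OrthonormalBasis (Fin n) ℝ V) (J : Fin m → Fin n) (v : Fin m → V) :
    wedge (fun i => dualBasis b (J i)) v =
      ((Matrix.of fun i l => inner ℝ (b (J i)) (v l)).det : ℝ) := by
  rw [wedge_apply]
  simp [dualBasis_apply]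

theorem wedge_dualBasis_orderEmb [MeasurableSpace V] [BorelSpace V] {m n : ℕ}
    (b : OrthonormalBasis (Fin n) ℝ V) (J L : Fin m ↪o Fin n) :
    wedge (fun i => dualBasis b (J i)) (fun i => b (L i)) = if J = L then 1 else 0 := by
  rw [wedge_dualBasis_apply]
  simp only [orthonormal_iff_ite.1 b.orthonormal]
  split_ifs with h
  · subst h
    simp only [EmbeddingLike.apply_eq_iff_eq]
    have : (Matrix.of fun i l : Fin m => if i = l then (1 : ℝ) else 0) = 1 := by
      ext i l
      simp [Matrix.one_apply]
    rw [this, Matrix.det_one, Complex.ofReal_one]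
  -- An increasing map is determined by its image, so for `J ≠ L` some value `L l` is missed by `J`,
  -- and column `l` vanishes.
  · obtain ⟨l, hl⟩ : ∃ l, ∀ i, J i ≠ L l := by
      by_contra! hcon
      apply h
      choose f hf using hcon
      have hs : ∀ x, L x ∈ Finset.univ.map J.toEmbedding := fun x =>
        Finset.mem_map.2 ⟨f x, Finset.mem_univ _, hf x⟩
      have hcard : (Finset.univ.map J.toEmbedding).card = m := by simp
      rw [Finset.orderEmbOfFin_unique' hcard hs]
      exact Finset.orderEmbOfFin_unique' hcard fun x => Finset.mem_map.2 ⟨x, Finset.mem_univ _, rfl⟩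
    rw [Matrix.det_eq_zero_of_column_eq_zero l fun i => by simp [hl i], Complex.ofReal_zero]

/-- By duality of the wedge products only the summand `J` survives. This computes both the forms
`ψ_I` and the star in `barCurrent`. -/
theorem hodge_wedge_dualBasis [MeasurableSpace V] [BorelSpace V] {W : Type u}
    [NormedAddCommGroup W] [NormedSpace ℝ W] {m k n : ℕ} (c : Basis (Fin n) ℝ W)
    (b : OrthonormalBasis (Fin n) ℝ V) (e : Fin k ⊕ Fin m ≃ Fin n) (J : Fin m ↪o Fin n) :
    hodge c b.toBasis e (wedge fun i => dualBasis b (J i)) =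
      Complex.ofRealCLM.compContinuousAlternatingMap (partialDet c e fun i => c (J i)) := by
  change ∑ L : Fin m ↪o Fin n, _ = _
  simp only [OrthonormalBasis.coe_toBasis, wedge_dualBasis_orderEmb]
  rw [Finset.sum_eq_single J]
  · rw [if_pos rfl]
    exact one_smul ℂ _
  · intro L _ hL
    rw [if_neg hL.symm]
    ext v
    rw [ContinuousAlternatingMap.smul_apply, zero_smul]
    rfl
  · simp

/-- The two stars compose to a scalar because each involves the shuffle sign of `J` and its
complement, and these cancel. What matters later is that the remaining sign depends on `e₁` and `e₂`
but not on `J`. -/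
theorem hodge_partialDet [MeasurableSpace V] [BorelSpace V] {m k n : ℕ}
    (b : OrthonormalBasis (Fin n) ℝ V) (e₁ : Fin m ⊕ Fin k ≃ Fin n) (e₂ : Fin k ⊕ Fin m ≃ Fin n)
    (J : Fin m ↪o Fin n) :
    hodge b.toBasis (dualBasis b) e₁ (Complex.ofRealCLM.compContinuousAlternatingMap
        (partialDet (dualBasis b) e₂ fun i => dualBasis b (J i))) =
      ((Equiv.Perm.sign ((e₁.symm.trans (Equiv.sumComm _ _)).trans e₂) : ℝ) : ℂ) •
        wedge fun i => dualBasis b (J i) := by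
  have hmn : m + k = n := by simpa using Fintype.card_congr e₁
  set s : Finset (Fin n) := Finset.univ.map J.toEmbedding with hs
  have hm : s.card = m := by simp [hs]
  have hk : sᶜ.card = k := by rw [Finset.card_compl, hm, Fintype.card_fin]; omega
  let F : Fin m ⊕ Fin k ≃ Fin n := finSumEquivOfFinset hm hk
  let J' : Fin k ↪o Fin n := sᶜ.orderEmbOfFin hk
  have hJ : J = s.orderEmbOfFin hm :=
    Finset.orderEmbOfFin_unique' hm fun x => Finset.mem_map.2 ⟨x, Finset.mem_univ _, rfl⟩
  have hFl : ∀ i, F (Sum.inl i) = J i := fun i => by rw [hJ]; exact finSumEquivOfFinset_inl hm hk i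
  have hFr : ∀ i, F (Sum.inr i) = J' i := fun i => finSumEquivOfFinset_inr hm hk i
  -- An `L` other than the complement `J'` shares a value with `J`, and the determinant has a
  -- repeated argument.
  have hzero : ∀ L : Fin k ↪o Fin n, L ≠ J' → (dualBasis b).det
      (fun i => Sum.elim (fun i => dualBasis b (L i)) (fun i => dualBasis b (J i)) (e₂.symm i)) = 0 := by
    intro L hL
    obtain ⟨x, y, hxy⟩ : ∃ x y, L x = J y := by
      by_contra! hcon
      refine hL (Finset.orderEmbOfFin_unique' hk fun x => ?_)
      simp only [hs, Finset.mem_compl, Finset.mem_map, Finset.mem_univ, true_and, not_exists]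
      exact fun y h => hcon x y h.symm
    refine (dualBasis b).det.map_eq_zero_of_eq (i := e₂ (Sum.inl x)) (j := e₂ (Sum.inr y)) _ ?_ ?_
    · simp [hxy]
    · simp
  have h2 : (dualBasis b).det
      (fun i => Sum.elim (fun i => dualBasis b (J' i)) (fun i => dualBasis b (J i)) (e₂.symm i)) =
      (Equiv.Perm.sign ((e₂.symm.trans (Equiv.sumComm _ _)).trans F) : ℝ) := by
    have h := (dualBasis b).det.map_perm (dualBasis b) ((e₂.symm.trans (Equiv.sumComm _ _)).trans F)
    rw [Basis.det_self, Units.smul_def, zsmul_eq_mul, mul_one] at h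
    rw [← h]
    congr 1
    funext i
    rcases hi : e₂.symm i with r | r <;> simp [hi, hFl, hFr]
  have h1 : b.toBasis.det
      (fun i => Sum.elim (fun i => b (J i)) (fun i => b (J' i)) (e₁.symm i)) =
      (Equiv.Perm.sign (e₁.symm.trans F) : ℝ) := by
    have h := b.toBasis.det.map_perm b.toBasis (e₁.symm.trans F)
    rw [Basis.det_self, Units.smul_def, zsmul_eq_mul, mul_one] at h
    rw [← h]
    congr 1
    funext i
    rcases hi : e₁.symm i with r | r <;> simp [hi, hFl, hFr]
  have hblock : ∀ w : Fin m → V, b.toBasis.det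
      (fun i => Sum.elim w (fun i => b (J' i)) (e₁.symm i)) =
      (Matrix.of fun i l => inner ℝ (b (J i)) (w l)).det * (Equiv.Perm.sign (e₁.symm.trans F) : ℝ) := by
    intro w
    have h := OrthonormalBasis.det_sumElim_eq_mul b (b.reindex F.symm) e₁ w (fun i => b (J' i))
      (fun i r => by
        rw [OrthonormalBasis.reindex_apply, ← hFr, orthonormal_iff_ite.1 b.orthonormal, if_neg]
        simp)
    simp only [OrthonormalBasis.reindex_apply, Equiv.symm_symm, hFl] at h
    rw [h, h1]
  -- The shuffle `F` occurs in both signs and drops out.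
  have hsign : (Equiv.Perm.sign ((e₂.symm.trans (Equiv.sumComm _ _)).trans F) : ℝ) *
      (Equiv.Perm.sign (e₁.symm.trans F) : ℝ) =
      (Equiv.Perm.sign ((e₁.symm.trans (Equiv.sumComm _ _)).trans e₂) : ℝ) := by
    have h : e₁.symm.trans F = ((e₁.symm.trans (Equiv.sumComm _ _)).trans e₂).trans
        ((e₂.symm.trans (Equiv.sumComm _ _)).trans F) := by
      ext i
      simp
    rw [h, Equiv.Perm.sign_trans, Units.val_mul, Int.cast_mul, ← mul_assoc]
    have : ∀ u : ℤˣ, ((u : ℤ) : ℝ) * ((u : ℤ) : ℝ) = 1 := by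
      intro u
      rcases Int.units_eq_one_or u with h | h <;> simp [h]
    rw [this, one_mul]
  change ∑ L : Fin k ↪o Fin n, _ = _
  rw [Finset.sum_eq_single J']
  · ext v
    have e1 : (partialDet (dualBasis b) e₂ fun i => dualBasis b (J i)) (fun i => dualBasis b (J' i)) =
        (dualBasis b).det (fun i => Sum.elim (fun i => dualBasis b (J' i))
          (fun i => dualBasis b (J i)) (e₂.symm i)) := rfl
    have e2 : (partialDet b.toBasis e₁ fun i => b.toBasis (J' i)) v =
        b.toBasis.det (fun i => Sum.elim v (fun i => b (J' i)) (e₁.symm i)) := by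
      rw [OrthonormalBasis.coe_toBasis]; rfl
    simp only [ContinuousAlternatingMap.smul_apply, wedge_dualBasis_apply,
      ContinuousLinearMap.compContinuousAlternatingMap_coe, Function.comp_apply,
      Complex.ofRealCLM_apply, smul_eq_mul]
    rw [e1, e2, h2, hblock, ← hsign]
    push_cast
    ring
  · intro L _ hL
    have e1 : (partialDet (dualBasis b) e₂ fun i => dualBasis b (J i)) (fun i => dualBasis b (L i)) =
        (dualBasis b).det (fun i => Sum.elim (fun i => dualBasis b (L i))
          (fun i => dualBasis b (J i)) (e₂.symm i)) := rfl
    simp only [ContinuousLinearMap.compContinuousAlternatingMap_coe, Function.comp_apply]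
    rw [e1, hzero L hL, Complex.ofRealCLM_apply, Complex.ofReal_zero]
    ext v
    rw [ContinuousAlternatingMap.smul_apply, zero_smul]
    rfl
  · simp

end

/-! ### Fibre integration of decomposable test forms -/

section
variable {W : Type u} [NormedAddCommGroup W] [NormedSpace ℝ W]
  {F : Type u} [NormedAddCommGroup F] [NormedSpace ℝ F] [NormedSpace ℂ F] [IsScalarTower ℝ ℂ F]

theorem testForms.postcomp_tensorTest {G : Type u} [NormedAddCommGroup G] [NormedSpace ℝ G]
    [NormedSpace ℂ G] [IsScalarTower ℝ ℂ G] {k : ℕ} (L : F →L[ℂ] G) (ψ : W [⋀^Fin k]→L[ℝ] ℂ)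
    (f : F) (g : testFunctions W) :
    testForms.postcomp L (tensorTest ψ f g) = tensorTest ψ (L f) g := by
  ext1
  funext η
  ext1 u
  change L (g.1 η • (ψ u • f)) = g.1 η • (ψ u • L f)
  rw [map_smul, map_smul]

/-- Fibre integration of a test form `g ψ ⊗ f`. -/
theorem fiberIntegral_tensorTest_apply [FiniteDimensional ℝ W] [CompleteSpace F] (m j : ℕ) (ψ : W [⋀^Fin (j + 1)]→L[ℝ] ℂ) (f : F)
    (g : testFunctions W) (ξ : W) (v : Fin j → W) :
    (fiberIntegral m j (tensorTest ψ f g)).1 ξ v =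
      (((-1 : ℂ) ^ m * ∫ t in Set.Ioi (0 : ℝ), (t : ℂ) ^ j * g.1 (t • ξ)) *
        ψ (Fin.cons ξ v)) • f := by
  have h0 : (fiberIntegral m j (tensorTest ψ f g)).1 ξ v = (-1 : ℝ) ^ m •
      (∫ t in Set.Ioi (0 : ℝ), t ^ j • ((tensorTest ψ f g).1 (t • ξ)).curryLeft ξ) v := rfl
  have h := (ContinuousAlternatingMap.apply ℝ W F v).integral_comp_comm
    (integrable_ray (tensorTest ψ f g) ξ)
  simp only [ContinuousAlternatingMap.apply_apply] at h
  rw [h0, ← h]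
  have hs : ∀ (r : ℝ) (x : F), r • x = (r : ℂ) • x := fun r x => (algebraMap_smul ℂ r x).symm
  have h1 : ∀ t : ℝ, (t ^ j • ((tensorTest ψ f g).1 (t • ξ)).curryLeft ξ) v =
      ((t : ℂ) ^ j * g.1 (t • ξ)) • (ψ (Fin.cons ξ v) • f) := by
    intro t
    have h2 : (((tensorTest ψ f g).1 (t • ξ)).curryLeft ξ) v =
        g.1 (t • ξ) • (ψ (Fin.cons ξ v) • f) := rfl
    rw [ContinuousAlternatingMap.smul_apply, h2, mul_smul, hs, Complex.ofReal_pow]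
  simp_rw [h1]
  rw [integral_smul_const, mul_smul, mul_smul, hs]
  push_cast
  rfl

end

/-! ### Symmetry of the integrand, the valuations and the current -/

section
variable {V : Type u} [NormedAddCommGroup V] [InnerProductSpace ℝ V] [FiniteDimensional ℝ V]
  [MeasurableSpace V] [BorelSpace V]

/-- The integrand over the normal cycle of a form `h (⋆ b_I ⌟ ξ) ⊗ b_J^*` is symmetric in `I`
and `J`. -/
theorem normalCycleIntegrand_symm {m j : ℕ} (b : OrthonormalBasis (Fin (m + (j + 1))) ℝ V)
    (e : Fin (j + 1) ⊕ Fin m ≃ Fin (m + (j + 1))) (h : StrongDual ℝ V → ℂ)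
    (I J : Fin m → Fin (m + (j + 1)))
    (α β : StrongDual ℝ V → StrongDual ℝ V [⋀^Fin j]→L[ℝ] (V [⋀^Fin m]→L[ℝ] ℂ))
    (hα : ∀ ξ v w, α ξ v w = h ξ * partialDet (dualBasis b) e (fun i => dualBasis b (I i))
      (Fin.cons ξ v) * wedge (fun i => dualBasis b (J i)) w)
    (hβ : ∀ ξ v w, β ξ v w = h ξ * partialDet (dualBasis b) e (fun i => dualBasis b (J i))
      (Fin.cons ξ v) * wedge (fun i => dualBasis b (I i)) w)
    (K : ConvexBody V) (x : V) (hx : DifferentiableAt ℝ (nearest K) x) :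
    normalCycleIntegrand b α K x = normalCycleIntegrand b β K x := by
  -- The order of slots in `d(dist) ∧ G^* α`: the differential of the distance at position `0`, then
  -- the `m` covectors of `V`, then the `j` covectors of `V^*`.
  let E : (Fin m ⊕ Fin j) ⊕ Fin 1 ≃ Fin (m + (j + 1)) :=
    (((Equiv.sumCongr finSumFinEquiv (Equiv.ofUnique (Fin 1) PUnit.{1})).trans
      (Equiv.optionEquivSumPUnit _).symm).trans (finSuccEquiv (m + j)).symm)
  have key := sum_perm_symm_of_isSymmetric b ((Equiv.sumComm _ _).trans e)
    (fderiv ℝ (nearest K) x : V →ₗ[ℝ] V) (isSymmetric_fderiv_nearest K x hx)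
    (x - nearest K x) (fderiv_nearest_apply_sub K x hx)
    (fderiv ℝ (fun y => Metric.infDist y (K : Set V)) x : V →ₗ[ℝ] ℝ) E
  have hint : ∀ (I J : Fin m → Fin (m + (j + 1)))
      (α : StrongDual ℝ V → StrongDual ℝ V [⋀^Fin j]→L[ℝ] (V [⋀^Fin m]→L[ℝ] ℂ))
      (_ : ∀ ξ v w, α ξ v w = h ξ * partialDet (dualBasis b) e (fun i => dualBasis b (I i))
        (Fin.cons ξ v) * wedge (fun i => dualBasis b (J i)) w),
      normalCycleIntegrand b α K x = ((m.factorial : ℂ) * j.factorial)⁻¹ *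
        (h (innerSL ℝ (x - nearest K x)) * ((∑ σ : Equiv.Perm (Fin (m + (j + 1))),
        (Equiv.Perm.sign σ : ℝ) * ((Matrix.of fun i l => inner ℝ (b (J i))
          ((fderiv ℝ (nearest K) x : V →ₗ[ℝ] V) (b (σ (E (Sum.inl (Sum.inl l))))))).det *
        b.toBasis.det (fun i => Sum.elim (fun i => b (I i)) (Fin.cons (x - nearest K x) fun i =>
          b (σ (E (Sum.inl (Sum.inr i)))) - (fderiv ℝ (nearest K) x : V →ₗ[ℝ] V)
            (b (σ (E (Sum.inl (Sum.inr i))))) ) (((Equiv.sumComm _ _).trans e).symm i)) *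
        (fderiv ℝ (fun y => Metric.infDist y (K : Set V)) x : V →ₗ[ℝ] ℝ)
          (b (σ (E (Sum.inr 0))))) : ℝ) : ℂ)) := by
    intro I J α hα
    unfold normalCycleIntegrand
    congr 1
    rw [Complex.ofReal_sum, Finset.mul_sum]
    refine Finset.sum_congr rfl fun σ _ => ?_
    have hE0 : E (Sum.inr 0) = (0 : Fin ((m + j) + 1)) := by simp [E]
    have hE1 : ∀ i, E (Sum.inl (Sum.inl i)) = Fin.succ (Fin.castAdd j i) := by
      intro i; simp [E]
    have hE2 : ∀ i, E (Sum.inl (Sum.inr i)) = Fin.succ (Fin.natAdd m i) := by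
      intro i; simp [E]
    -- The second component of `G` has differential `1 - Dp(x)` followed by the isometry `V ≃ V^*`,
    -- which carries `b` to its dual basis.
    have hdet : ∀ v : Fin j → V, partialDet (dualBasis b) e (fun i => dualBasis b (I i))
        (Fin.cons (innerSL ℝ (x - nearest K x)) fun i => innerSL ℝ (v i - fderiv ℝ (nearest K) x (v i)))
        = b.toBasis.det (fun i => Sum.elim (fun i => b (I i)) (Fin.cons (x - nearest K x) fun i =>
          v i - fderiv ℝ (nearest K) x (v i)) (((Equiv.sumComm _ _).trans e).symm i)) := by
      intro v
      rw [← det_dualBasis_innerSL]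
      change (dualBasis b).det _ = _
      congr 1
      funext i
      rcases hi : e.symm i with r | r
      · induction r using Fin.cases <;> simp [hi]
      · simp [hi, dualBasis_apply]
    rw [hα, (hasFDerivAt_innerSL_sub_nearest K x hx).fderiv, wedge_dualBasis_apply]
    simp only [hE0, hE1, hE2, ContinuousLinearMap.coe_coe, ContinuousLinearMap.comp_apply,
      sub_apply, ContinuousLinearMap.id_apply]
    rw [hdet]
    push_cast
    ring
  rw [hint I J α hα, hint J I β hβ, key I J]

/-- By Rademacher's theorem the Lipschitz map `nearest K` is differentiable almost everywhere, so
the two integrands agree almost everywhere. -/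
theorem normalCycleValuation_symm {m j : ℕ} (b : OrthonormalBasis (Fin (m + (j + 1))) ℝ V)
    (e : Fin (j + 1) ⊕ Fin m ≃ Fin (m + (j + 1))) (h : StrongDual ℝ V → ℂ)
    (I J : Fin m → Fin (m + (j + 1)))
    (α β : projForms (StrongDual ℝ V) j (V [⋀^Fin m]→L[ℝ] ℂ))
    (hα : ∀ ξ v w, α.1 ξ v w = h ξ * partialDet (dualBasis b) e (fun i => dualBasis b (I i))
      (Fin.cons ξ v) * wedge (fun i => dualBasis b (J i)) w)
    (hβ : ∀ ξ v w, β.1 ξ v w = h ξ * partialDet (dualBasis b) e (fun i => dualBasis b (J i))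
      (Fin.cons ξ v) * wedge (fun i => dualBasis b (I i)) w) :
    normalCycleValuation b α = normalCycleValuation b β := by
  funext K
  refine integral_congr_ae (ae_restrict_of_ae ?_)
  filter_upwards [(lipschitz_nearest K).ae_differentiableAt (μ := volume)] with x hx
  exact normalCycleIntegrand_symm b e h I J α.1 β.1 hα hβ K x hx

/-- The components of the current of a generalized valuation are symmetric. -/
theorem barCurrent_tensorTest_symm (m k : ℕ) (b : OrthonormalBasis (Fin (m + k)) ℝ V)
    (φ : GeneralizedValuation m k b) (g : testFunctions (StrongDual ℝ V))
    (I J : Fin m ↪o Fin (m + k)) :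
    barCurrent b (zeroHomogeneousCurrent m k b φ) (tensorTest
      (hodge (dualBasis b) b.toBasis ((Equiv.sumComm _ _).trans finSumFinEquiv)
        (wedge fun i => dualBasis b (I i))) (wedge fun i => dualBasis b (J i)) g) =
    barCurrent b (zeroHomogeneousCurrent m k b φ) (tensorTest
      (hodge (dualBasis b) b.toBasis ((Equiv.sumComm _ _).trans finSumFinEquiv)
        (wedge fun i => dualBasis b (J i))) (wedge fun i => dualBasis b (I i)) g) := by
  -- For `k = 0` the degree `m` is the full dimension and there is only one increasing multi-index.
  rcases k with _ | j
  · have h : I = J := by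
      have hall : ∀ L : Fin m ↪o Fin (m + 0), L = Finset.univ.orderEmbOfFin (by simp) :=
        fun L => Finset.orderEmbOfFin_unique' _ fun _ => Finset.mem_univ _
      rw [hall I, hall J]
    rw [h]
  · rw [hodge_wedge_dualBasis, hodge_wedge_dualBasis]
    set e : Fin (j + 1) ⊕ Fin m ≃ Fin (m + (j + 1)) := (Equiv.sumComm _ _).trans finSumFinEquiv
    set e₂ : Fin (j + 1) ⊕ Fin m ≃ Fin (m + (j + 1)) :=
      finSumFinEquiv.trans (finCongr (add_comm (j + 1) m)) with he₂
    set ε : ℂ := ((Equiv.Perm.sign ((finSumFinEquiv.symm.trans (Equiv.sumComm _ _)).trans e₂) : ℝ) : ℂ)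
      with hε
    -- The form on `ℙ₊(V^*)` to whose valuation `φ` is finally applied.
    let γ (I J : Fin m ↪o Fin (m + (j + 1))) :
        projForms (StrongDual ℝ V) j (V [⋀^Fin m]→L[ℝ] ℂ) :=
      projForms.postcomp (hodge b.toBasis (dualBasis b) finSumFinEquiv)
        (fiberIntegral m j (testForms.postcomp (hodge (dualBasis b) b.toBasis e₂) (tensorTest
          (Complex.ofRealCLM.compContinuousAlternatingMap
            (partialDet (dualBasis b) e fun i => dualBasis b (I i)))
          (wedge fun i => dualBasis b (J i)) g)))
    -- The scalar prefactor, which collects the fibre integral of `g` and all signs, depends on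
    -- neither `I` nor `J`; it is the function `h` of `normalCycleValuation_symm`.
    have hγ : ∀ I J ξ v w, (γ I J).1 ξ v w =
        (((-1 : ℂ) ^ m * ∫ t in Set.Ioi (0 : ℝ), (t : ℂ) ^ j * g.1 (t • ξ)) * ε) *
          partialDet (dualBasis b) e (fun i => dualBasis b (I i)) (Fin.cons ξ v) *
          wedge (fun i => dualBasis b (J i)) w := by
      intro I J ξ v w
      have h1 : testForms.postcomp (hodge (dualBasis b) b.toBasis e₂) (tensorTest
          (Complex.ofRealCLM.compContinuousAlternatingMap
            (partialDet (dualBasis b) e fun i => dualBasis b (I i)))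
          (wedge fun i => dualBasis b (J i)) g) = tensorTest
          (Complex.ofRealCLM.compContinuousAlternatingMap
            (partialDet (dualBasis b) e fun i => dualBasis b (I i)))
          (hodge (dualBasis b) b.toBasis e₂ (wedge fun i => dualBasis b (J i))) g :=
        testForms.postcomp_tensorTest _ _ _ _
      have h2 : (γ I J).1 ξ v = hodge b.toBasis (dualBasis b) finSumFinEquiv
          ((fiberIntegral m j (tensorTest
          (Complex.ofRealCLM.compContinuousAlternatingMap
            (partialDet (dualBasis b) e fun i => dualBasis b (I i)))
          (hodge (dualBasis b) b.toBasis e₂ (wedge fun i => dualBasis b (J i))) g)).1 ξ v) := by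
        rw [← h1]
        rfl
      rw [h2, fiberIntegral_tensorTest_apply, map_smul, hodge_wedge_dualBasis, hodge_partialDet,
        ContinuousAlternatingMap.smul_apply, ContinuousAlternatingMap.smul_apply, ← hε]
      simp only [ContinuousLinearMap.compContinuousAlternatingMap_coe, Function.comp_apply,
        Complex.ofRealCLM_apply, smul_eq_mul]
      ring
    have hν : (normalCycleValuation b).rangeRestrict (γ I J) =
        (normalCycleValuation b).rangeRestrict (γ J I) :=
      Subtype.ext (normalCycleValuation_symm b e
        (fun ξ => ((-1 : ℂ) ^ m * ∫ t in Set.Ioi (0 : ℝ), (t : ℂ) ^ j * g.1 (t • ξ)) * ε) I J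
        (γ I J) (γ J I) (hγ I J) (hγ J I))
    change (-1 : ℂ) ^ ((j + 1) * m) • φ.toFun ((normalCycleValuation b).rangeRestrict (γ I J)) =
      (-1 : ℂ) ^ ((j + 1) * m) • φ.toFun ((normalCycleValuation b).rangeRestrict (γ J I))
    rw [hν]

end

/-! ### From symmetric components to symmetric tensors -/

section
variable {V : Type u} [NormedAddCommGroup V] [InnerProductSpace ℝ V]

/-- Symmetric components give elements of `Sym² (Λ^m V) ⊗ Dens(V)`. -/
theorem sum_tmul_mem_symSqDens {κ : Type*} [Fintype κ] {m n : ℕ} (a : κ → ⋀[ℝ]^m V)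
    (d : κ → κ → Dens V n) (hd : ∀ i l, d i l = d l i) :
    ∑ i, ∑ l, (a i ⊗ₜ[ℝ] a l) ⊗ₜ[ℝ] d i l ∈ symSqDens V m n := by
  -- Average the sum with its copy in which `i` and `l` are exchanged; the coefficients are
  -- unchanged by `hd`.
  have h : ∑ i, ∑ l, (a i ⊗ₜ[ℝ] a l) ⊗ₜ[ℝ] d i l =
      (2⁻¹ : ℝ) • ∑ i, ∑ l, (a i ⊗ₜ[ℝ] a l + a l ⊗ₜ[ℝ] a i) ⊗ₜ[ℝ] d i l := by
    simp only [TensorProduct.add_tmul, Finset.sum_add_distrib]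
    rw [Finset.sum_comm (f := fun i l => (a l ⊗ₜ[ℝ] a i) ⊗ₜ[ℝ] d i l)]
    simp only [fun i l => hd l i]
    rw [← two_smul ℝ, smul_smul]
    norm_num
  rw [h]
  refine Submodule.smul_mem _ _ (Submodule.sum_mem _ fun i _ => Submodule.sum_mem _ fun l _ => ?_)
  refine ⟨(⟨a i ⊗ₜ[ℝ] a l + a l ⊗ₜ[ℝ] a i, ?_⟩ : symSq (⋀[ℝ]^m V)) ⊗ₜ[ℝ] d i l, ?_⟩
  · simp [symSq, LinearMap.mem_eqLocus, add_comm]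
  · simp

end

theorem mainTheorem10 {V : Type*} [NormedAddCommGroup V] [InnerProductSpace ℝ V]
    [FiniteDimensional ℝ V] [MeasurableSpace V] [BorelSpace V] (m k : ℕ)
    (b : OrthonormalBasis (Fin (m + k)) ℝ V) (φ : GeneralizedValuation m k b)
    (g : testFunctions (StrongDual ℝ V)) :
    toTensorDistribution b (barCurrent b (zeroHomogeneousCurrent m k b φ)) g ∈
      symSqDens V m (m + k) := by
  have h := sum_tmul_mem_symSqDens (V := V) (n := m + k)
    (fun I : Fin m ↪o Fin (m + k) => exteriorPower.ιMulti ℝ m fun i => b (I i))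
    (fun I J => barCurrent b (zeroHomogeneousCurrent m k b φ) (tensorTest
      (hodge (dualBasis b) b.toBasis ((Equiv.sumComm _ _).trans finSumFinEquiv)
        (wedge fun i => dualBasis b (I i))) (wedge fun i => dualBasis b (J i)) g) •
        lebesgueDens b.toBasis)
    fun I J => by rw [barCurrent_tensorTest_symm]
  convert h
  simp only [toTensorDistribution, LinearMap.sum_apply]
  rfl
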